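/- Let $V$ be a finite-dimensional real vector space with a $\mathbb Q$-structure $V(\mathbb Q)$ (the $\mathbb Q$-span of a real basis), and let $C\subset V$ be a nonempty open convex cone that contains no affine line. Let $C_+$ denote the convex hull of $\overline C\cap V(\mathbb Q)$. A \emph{(rationally) polyhedral cone} is the solution set of finitely many linear inequalities $f\ge 0$ (with linear forms $f$ defined over $\mathbb Q$), and a \emph{lattice} in $V(\mathbb Q)$ is a discrete subgroup of $V$ that is contained in $V(\mathbb Q)$ and spans $V$. A cone is nonempty and stable under multiplication with positive reals; a face of a convex set is a nonempty convex extreme subset of it; $\dot\sigma$ is the relative interior of $\sigma$. For a subgroup $\Gamma\subset \mathrm{GL}(V)$ that stabilizes $C$ and some lattice in $V(\mathbb Q)$, the triple $(V(\mathbb Q),C,\Gamma)$, or the pair $(C_+,\Gamma)$, is said to be \emph{of polyhedral type} if there is a polyhedral cone $\Pi\subset C_+$ with $\Gamma\cdot\Pi=C_+$. Assume that this is so. A \emph{locally rationally polyhedral decomposition} of $C_+$ is a collection $\Sigma$ of convex cones in $C_+$ such that (i) the relative interiors of the members of $\Sigma$ are pairwise disjoint with union $C_+$; (ii) $\Sigma$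 is closed under intersections and under taking faces; (iii) for every rationally polyhedral cone $\Pi\subset C_+$, $\{\sigma\cap\Pi\}_{\sigma\in\Sigma}$ is a finite collection of rationally polyhedral cones. Let $\Sigma$ be a $\Gamma$-invariant locally rationally polyhedral decomposition of $C_+$ and let $\sigma\in\Sigma$. Let $V_\sigma$ be the linear span of $\sigma$, and let $\Gamma(\sigma)\subset\mathrm{GL}(V_\sigma)$ be the group of automorphisms induced by the elements of $\Gamma$ that map $\sigma$ onto itself. Then: (1) $(\sigma,\Gamma(\sigma))$ is of polyhedral type. That is, $V_\sigma\cap V(\mathbb Q)$ is a $\mathbb Q$-structure on $V_\sigma$, in which $\sigma=(\dot\sigma)_+$, and the triple $(V_\sigma\cap V(\mathbb Q),\dot\sigma,\Gamma(\sigma))$ is of polyhedral type. (2) If $F$ is the smallest face of $C_+$ that contains $\sigma$ and $Z_\Gamma(F)$ is the group of $\gamma\in\Gamma$ that fix $F$ pointwise, then the collection $\{\tau\in\Sigma \mid \tau\supseteq\sigma\}$ is stable under $Z_\Gamma(F)$ and decomposes into finitely many $Z_\Gamma(F)$-equivalence classes. -/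

import Mathlib

open Module

section ConeGeometry

variable {V : Type*} [NormedAddCommGroup V] [NormedSpace ℝ V]

/-- A convex cone: a nonempty convex set that is stable under multiplication with positive reals
(it need not contain the origin). -/
structure IsConvexCone (X : Set V) : Prop where
  nonempty : X.Nonempty
  convex : Convex ℝ X
  smul_mem : ∀ c : ℝ, 0 < c → ∀ x ∈ X, c • x ∈ X

/-- A set is nondegenerate if it contains no affine line. -/
def IsNondegenerate (X : Set V) : Prop :=
  ∀ x v : V, v ≠ 0 → ∃ t : ℝ, x + t • v ∉ X

/-- `Y` is a face of `X`: a nonempty convex subset of `X` such that every segment in `X` that meets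
`Y` in a point which is not an end point has its end points in `Y`. -/
def IsFace (Y X : Set V) : Prop :=
  Y.Nonempty ∧ Convex ℝ Y ∧ IsExtreme ℝ X Y

/-- The smallest face of a convex set `X` that contains the nonempty subset `Y` of `X`. -/
def smallestFace (X Y : Set V) : Set V :=
  ⋂₀ {F | IsFace F X ∧ Y ⊆ F}

theorem isLeast_smallestFace {X Y : Set V} (hX : Convex ℝ X) (hY : Y.Nonempty) (hYX : Y ⊆ X) :
    IsLeast {F | IsFace F X ∧ Y ⊆ F} (smallestFace X Y) := by
  have hmem : X ∈ {F | IsFace F X ∧ Y ⊆ F} :=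
    ⟨⟨hY.mono hYX, hX, IsExtreme.refl ℝ X⟩, hYX⟩
  have hsub : Y ⊆ smallestFace X Y := Set.subset_sInter fun F hF => hF.2
  exact ⟨⟨⟨hY.mono hsub, convex_sInter fun F hF => hF.1.2.1,
    isExtreme_sInter ⟨X, hmem⟩ fun F hF => hF.1.2.2⟩, hsub⟩, fun F hF => Set.sInter_subset_of_mem hF⟩

/-- A polyhedral cone: the solution set of finitely many linear inequalities. -/
def IsPolyhedralCone (P : Set V) : Prop :=
  ∃ S : Set (Dual ℝ V), S.Finite ∧ P = {x | ∀ f ∈ S, 0 ≤ f x}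

end ConeGeometry

section RationalGeometry

variable {V : Type*} [NormedAddCommGroup V] [NormedSpace ℝ V] [Module ℚ V]

/-- `VQ` is a `ℚ`-structure on the real vector space `V`: the `ℚ`-span of an `ℝ`-basis of `V`. -/
def IsRationalStructure (VQ : Submodule ℚ V) : Prop :=
  ∃ b : Basis (Fin (finrank ℝ V)) ℝ V, VQ = Submodule.span ℚ (Set.range b)

/-- `L` is a lattice in `V` compatible with the `ℚ`-structure `VQ`. -/
def IsRationalLattice (VQ : Submodule ℚ V) (L : Submodule ℤ V) : Prop :=
  (∀ x ∈ L, x ∈ VQ) ∧ DiscreteTopology L ∧ Submodule.span ℝ (L : Set V) = ⊤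

/-- A rationally polyhedral cone: the solution set of finitely many linear inequalities given by
linear forms that are defined over `ℚ`, that is, take rational values on `VQ`. -/
def IsRationalPolyhedralCone (VQ : Submodule ℚ V) (P : Set V) : Prop :=
  ∃ S : Set (Dual ℝ V), S.Finite ∧ (∀ f ∈ S, ∀ v ∈ VQ, ∃ q : ℚ, f v = (q : ℝ)) ∧
    P = {x | ∀ f ∈ S, 0 ≤ f x}

/-- The cone `C₊`: the convex hull of the rational points in the closure of `C`. -/
def rationalHull (VQ : Submodule ℚ V) (C : Set V) : Set V :=
  convexHull ℝ (closure C ∩ (VQ : Set V))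

/-- `S` is a locally rationally polyhedral decomposition of `C₊` (`intrinsicInterior` is the
relative interior). -/
structure IsLocallyRationalDecomposition (VQ : Submodule ℚ V) (C : Set V) (S : Set (Set V)) :
    Prop where
  isConvexCone : ∀ σ ∈ S, IsConvexCone σ
  subset : ∀ σ ∈ S, σ ⊆ rationalHull VQ C
  pairwiseDisjoint : S.PairwiseDisjoint (intrinsicInterior ℝ)
  iUnion_eq : ⋃ σ ∈ S, intrinsicInterior ℝ σ = rationalHull VQ C
  inter_mem : ∀ σ ∈ S, ∀ τ ∈ S, σ ∩ τ ∈ S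
  face_mem : ∀ σ ∈ S, ∀ τ, IsFace τ σ → τ ∈ S
  locally_finite : ∀ P, IsRationalPolyhedralCone VQ P → P ⊆ rationalHull VQ C →
    {Q | ∃ σ ∈ S, Q = σ ∩ P}.Finite
  locally_polyhedral : ∀ P, IsRationalPolyhedralCone VQ P → P ⊆ rationalHull VQ C →
    ∀ σ ∈ S, IsRationalPolyhedralCone VQ (σ ∩ P)

/-- The triple `(V(ℚ), C, Γ)` is of polyhedral type: `V(ℚ)` is a `ℚ`-structure, `C` is an open
nondegenerate convex cone, `Γ` stabilizes `C` and some lattice in `V(ℚ)`, and the `Γ`-translates of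
some polyhedral cone in `C₊` cover exactly `C₊`. -/
structure IsPolyhedralTriple (VQ : Submodule ℚ V) (C : Set V) (Γ : Subgroup (V ≃ₗ[ℝ] V)) :
    Prop where
  isRationalStructure : IsRationalStructure VQ
  isConvexCone : IsConvexCone C
  isOpen : IsOpen C
  isNondegenerate : IsNondegenerate C
  image_eq : ∀ γ ∈ Γ, γ '' C = C
  exists_lattice : ∃ L : Submodule ℤ V, IsRationalLattice VQ L ∧
    ∀ γ ∈ Γ, γ '' (L : Set V) = (L : Set V)
  exists_cone : ∃ P : Set V, IsPolyhedralCone P ∧ P ⊆ rationalHull VQ C ∧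
    ⋃ γ ∈ Γ, γ '' P = rationalHull VQ C

/-- The rational points of the linear span of `K`. -/
noncomputable def rationalSpan (VQ : Submodule ℚ V) (K : Set V) : Submodule ℚ (Submodule.span ℝ K) :=
  VQ.comap ((Submodule.span ℝ K).subtype.restrictScalars ℚ)

/-- For a convex cone `K` in `V` and a group `G` of linear automorphisms of the linear span of `K`,
the pair `(K, G)` is of polyhedral type: in the linear span of `K`, with its induced
`ℚ`-structure, one has `K = C₊` for `C` the relative interior of `K`, and the triple given by this
`ℚ`-structure, `C` and `G` is of polyhedral type. -/
def IsPolyhedralPair (VQ : Submodule ℚ V) (K : Set V)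
    (G : Subgroup (Submodule.span ℝ K ≃ₗ[ℝ] Submodule.span ℝ K)) : Prop :=
  rationalHull (rationalSpan VQ K) (Subtype.val ⁻¹' intrinsicInterior ℝ K) = Subtype.val ⁻¹' K ∧
  IsPolyhedralTriple (rationalSpan VQ K) (Subtype.val ⁻¹' intrinsicInterior ℝ K) G

end RationalGeometry

section Groups

variable {V : Type*} [NormedAddCommGroup V] [NormedSpace ℝ V]

/-- `Γ(K)`: the group of linear automorphisms of the linear span of `K` that are induced by the
elements of `Γ` that map `K` onto itself. -/
def inducedGroup (Γ : Subgroup (V ≃ₗ[ℝ] V)) (K : Set V) :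
    Subgroup (Submodule.span ℝ K ≃ₗ[ℝ] Submodule.span ℝ K) where
  carrier := {δ | ∃ γ ∈ Γ, γ '' K = K ∧ ∀ x : Submodule.span ℝ K, (δ x : V) = γ (x : V)}
  one_mem' := ⟨1, Γ.one_mem, by simp, fun x => rfl⟩
  mul_mem' := by
    rintro a b ⟨g, hg, hgK, hga⟩ ⟨h, hh, hhK, hhb⟩
    refine ⟨g * h, Γ.mul_mem hg hh, ?_, fun x => ?_⟩
    · have : (g * h : V ≃ₗ[ℝ] V) '' K = g '' (h '' K) := by
        rw [Set.image_image]; rfl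
      rw [this, hhK, hgK]
    · change ((a (b x) : Submodule.span ℝ K) : V) = g (h (x : V))
      rw [hga, hhb]
  inv_mem' := by
    rintro a ⟨g, hg, hgK, hga⟩
    refine ⟨g⁻¹, Γ.inv_mem hg, ?_, fun x => ?_⟩
    · change (g.symm : V → V) '' K = K
      conv_lhs => rw [← hgK]
      rw [Set.image_image]
      simp
    · change ((a.symm x : Submodule.span ℝ K) : V) = g.symm (x : V)
      rw [LinearEquiv.eq_symm_apply, ← hga, LinearEquiv.apply_symm_apply]

/-- `Z_Γ(F)`: the elements of `Γ` that fix every point of `F`. -/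
def pointwiseStabilizer (Γ : Subgroup (V ≃ₗ[ℝ] V)) (F : Set V) : Subgroup (V ≃ₗ[ℝ] V) :=
  Γ ⊓ fixingSubgroup (V ≃ₗ[ℝ] V) F

/-- The star of `σ` in the collection `S`. -/
def coneStar (S : Set (Set V)) (σ : Set V) : Set (Set V) :=
  {τ | τ ∈ S ∧ σ ⊆ τ}

/-- The equivalence class of `τ` under the group `G`. -/
def translates (G : Subgroup (V ≃ₗ[ℝ] V)) (τ : Set V) : Set (Set V) :=
  {τ' | ∃ γ ∈ G, τ' = γ '' τ}

end Groups

/-! ### Polyhedral cones: passing between generators and inequalities over a given field. -/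

section PolyhedralCones

variable {V : Type*} [AddCommGroup V] [Module ℝ V]

/-! The crux is a finiteness statement about initial pieces of rational segments. Let `K` be the
closure of `C` and `L` an invariant lattice, and consider the linear forms that are integral on `L`
and positive on `K` outside the origin; `Γ` permutes them. On a cone generated by finitely many
lattice points of `K` such a form is determined, up to comparison, by a vector of natural numbers,
so by Dickson's lemma finitely many forms already realise the minimum of all of them
(`exists_finite_minimal_forms`). Moreover only finitely many elements of `Γ` carry one such form to
another (`finite_transporter`).

Let `x`, `y` be lattice points of `K`. For generic `w` and `s` small compared with the small number
`t`, the points `x + t • (y + s • w)` have one common, unique minimising form `η`. Each is moved by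
some element of `Γ` into the fixed cone `hull G₀`, and that element carries `η` to one of the
finitely many minimal forms of `hull G₀`. So these elements differ by a finite set, and a single `γ`
moves all the points into one larger finitely generated cone that does not depend on `x` and `y`.
Letting `s` and then `t` tend to 0 puts `γ x` and some `γ (x + t • y)` into it
(`exists_hull_segment`).

For (2), take `x` and `y` in the relative interiors of `σ` and of a member `τ ⊇ σ`. Then `x + t • y`
is relatively interior to `τ`, so `γ '' τ` is one of the finitely many members whose relative
interior meets the fixed cone. As `γ x` lies in that cone, `γ` lies in one of finitely many cosets
of the pointwise stabilizer of the face (`finite_cosets`); dividing by a coset representative moves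
`τ` into a finite set.

For (1), a point of `σ` is relatively interior to a face `τ` of `σ`. Move it into `hull G₀`: `τ`
becomes one of finitely many members, and by (2) `σ` becomes, up to elements that fix the point, one
of finitely many members too. Their intersections with `hull G₀`, carried back into `σ`, generate
the required cone (`exists_cover`). The equality of `σ` with the hull of the rational points in its
closure follows from local polyhedrality. -/

theorem mem_hull_finset {G : Finset V} {x : V} :
    x ∈ PointedCone.hull ℝ (G : Set V) ↔
      ∃ c : V → ℝ, (∀ g, 0 ≤ c g) ∧ ∑ g ∈ G, c g • g = x := by
  constructor
  · intro hx
    obtain ⟨c, hc, h0, rfl⟩ := PointedCone.mem_hull_set.1 hx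
    refine ⟨c, h0, ?_⟩
    rw [Finsupp.sum]
    refine (Finset.sum_subset (by exact_mod_cast hc) fun g _ hg => ?_).symm
    rw [Finsupp.notMem_support_iff.1 hg, zero_smul]
  · rintro ⟨c, hc, rfl⟩
    exact Submodule.sum_mem _ fun g hg =>
      PointedCone.smul_mem _ (hc g) (PointedCone.subset_hull (by exact_mod_cast hg))

theorem map_mem_hull_of_forall_mem {G H : Set V} (γ : V ≃ₗ[ℝ] V)
    (h : ∀ g ∈ G, γ g ∈ PointedCone.hull ℝ H) {x : V} (hx : x ∈ PointedCone.hull ℝ G) :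
    γ x ∈ PointedCone.hull ℝ H := by
  have hle : PointedCone.hull ℝ G ≤ (PointedCone.hull ℝ H).comap γ.toLinearMap :=
    Submodule.span_le.2 h
  exact hle hx

/-- A pointed cone contains the differences `f g • h - f h • g`, with `f g ≥ 0 ≥ f h`. -/
theorem smul_sub_smul_mem (P : PointedCone ℝ V) {f : Dual ℝ V} {g h : V} (hg : g ∈ P)
    (hh : h ∈ P) (hfg : 0 ≤ f g) (hfh : f h ≤ 0) : f g • h - f h • g ∈ P := by
  rw [sub_eq_add_neg, ← neg_smul]
  exact P.add_mem (P.smul_mem hfg hh) (P.smul_mem (neg_nonneg.2 hfh) hg)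

/-- The generators of the intersection of a finitely generated cone with a half space. -/
theorem exists_hull_eq_inter_halfspace (A : Set V) (f : Dual ℝ V)
    (hA : ∀ g ∈ A, ∀ h ∈ A, f g • h - f h • g ∈ A) (G : Finset V) (hG : (G : Set V) ⊆ A) :
    ∃ G' : Finset V, (G' : Set V) ⊆ A ∧
      ∀ x, x ∈ PointedCone.hull ℝ (G' : Set V) ↔
        x ∈ PointedCone.hull ℝ (G : Set V) ∧ 0 ≤ f x := by
  classical
  set Gp := G.filter fun g => 0 ≤ f g with hGp
  set Gn := G.filter fun g => ¬ 0 ≤ f g with hGn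
  have hsub : ∀ g ∈ Gp ∪ Finset.image₂ (fun g h => f g • h - f h • g) Gp Gn,
      g ∈ A ∧ g ∈ PointedCone.hull ℝ (G : Set V) ∧ 0 ≤ f g := by
    intro g hg
    rcases Finset.mem_union.1 hg with hg | hg
    · rw [hGp, Finset.mem_filter] at hg
      exact ⟨hG hg.1, PointedCone.subset_hull hg.1, hg.2⟩
    · obtain ⟨a, ha, b, hb, rfl⟩ := Finset.mem_image₂.1 hg
      rw [hGp, Finset.mem_filter] at ha
      rw [hGn, Finset.mem_filter, not_le] at hb
      refine ⟨hA _ (hG ha.1) _ (hG hb.1), smul_sub_smul_mem _ (PointedCone.subset_hull ha.1)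
        (PointedCone.subset_hull hb.1) ha.2 hb.2.le, le_of_eq ?_⟩
      simp only [map_sub, map_smul, smul_eq_mul]
      ring
  refine ⟨Gp ∪ Finset.image₂ (fun g h => f g • h - f h • g) Gp Gn, fun g hg => (hsub g hg).1,
    fun x => ⟨fun hx => ?_, ?_⟩⟩
  · refine ⟨Submodule.span_le.2 (fun g hg => (hsub g hg).2.1) hx, ?_⟩
    obtain ⟨c, hc, rfl⟩ := mem_hull_finset.1 hx
    rw [map_sum]
    refine Finset.sum_nonneg fun g hg => ?_
    rw [map_smul]
    exact mul_nonneg (hc g) (hsub g hg).2.2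
  · rintro ⟨hx, hfx⟩
    set P := PointedCone.hull ℝ
      ((Gp ∪ Finset.image₂ (fun g h => f g • h - f h • g) Gp Gn : Finset V) : Set V) with hP
    obtain ⟨c, hc, rfl⟩ := mem_hull_finset.1 hx
    rw [← Finset.sum_filter_add_sum_filter_not G fun g => 0 ≤ f g, ← hGp, ← hGn] at hfx ⊢
    set p := ∑ g ∈ Gp, c g • g with hp
    set m := ∑ g ∈ Gn, c g • g with hm
    have hpP : p ∈ P := Submodule.sum_mem _ fun g hg => P.smul_mem (hc g)
      (PointedCone.subset_hull (by exact_mod_cast Finset.mem_union_left _ hg))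
    have hfp : f p = ∑ g ∈ Gp, c g * f g := by simp [hp, map_sum]
    have hfm : f m = ∑ g ∈ Gn, c g * f g := by simp [hm, map_sum]
    have hneg : ∀ g ∈ Gn, f g < 0 := fun g hg => not_le.1 (Finset.mem_filter.1 hg).2
    have hA0 : 0 ≤ f p := hfp ▸ Finset.sum_nonneg fun g hg =>
      mul_nonneg (hc g) (Finset.mem_filter.1 hg).2
    have hB0 : f m ≤ 0 := hfm ▸ Finset.sum_nonpos fun g hg =>
      mul_nonpos_of_nonneg_of_nonpos (hc g) (hneg g hg).le
    -- Write `x = p + m` with `p` on the nonnegative side of `f` and `m` on the negative side. If `f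
    -- p = 0`, then `f m = 0` as well, which kills every term of `m`.
    rw [map_add] at hfx
    rcases hA0.eq_or_lt with hA1 | hA1
    · have hm0 : f m = 0 := by linarith
      have : m = 0 := by
        refine Finset.sum_eq_zero fun g hg => ?_
        have := (Finset.sum_eq_zero_iff_of_nonpos fun g hg =>
          mul_nonpos_of_nonneg_of_nonpos (hc g) (hneg g hg).le).1 (hfm ▸ hm0) g hg
        rcases mul_eq_zero.1 this with h | h
        · rw [h, zero_smul]
        · exact absurd h (hneg g hg).ne
      rw [this, add_zero]
      exact hpP
    -- Expanding bilinearly writes this vector as a nonnegative combination of the new generators;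
    -- `f p • (p + m)` is its sum with `(f p + f m) • p`.
    · have key : f p • m - f m • p ∈ P := by
        have : f p • m - f m • p =
            ∑ g ∈ Gp, ∑ h ∈ Gn, (c g * c h) • (f g • h - f h • g) := by
          simp only [smul_sub, Finset.sum_sub_distrib]
          congr 1
          · rw [hfp, hm, Finset.sum_smul]
            refine Finset.sum_congr rfl fun g _ => ?_
            rw [Finset.smul_sum]
            refine Finset.sum_congr rfl fun h _ => ?_
            simp only [smul_smul]
            congr 1; ring
          · rw [hfm, hp, Finset.sum_smul, Finset.sum_comm]
            refine Finset.sum_congr rfl fun g _ => ?_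
            rw [Finset.smul_sum]
            refine Finset.sum_congr rfl fun h _ => ?_
            simp only [smul_smul]
            congr 1; ring
        rw [this]
        refine Submodule.sum_mem _ fun g hg => Submodule.sum_mem _ fun h hh =>
          P.smul_mem (mul_nonneg (hc g) (hc h)) (PointedCone.subset_hull ?_)
        exact_mod_cast Finset.mem_union_right _ (Finset.mem_image₂_of_mem hg hh)
      have h2 : (f p)⁻¹ • ((f p + f m) • p + (f p • m - f m • p)) ∈ P :=
        P.smul_mem (inv_nonneg.2 hA0) (P.add_mem (P.smul_mem hfx hpP) key)
      have h3 : (f p + f m) • p + (f p • m - f m • p) = f p • (p + m) := by module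
      rwa [h3, smul_smul, inv_mul_cancel₀ hA1.ne', one_smul] at h2

/-- **Minkowski's theorem** on polyhedral cones, keeping track of the field of definition of the
generators. -/
theorem exists_hull_eq_of_finite (A : Set V) (B : Set (Dual ℝ V))
    (hAB : ∀ f ∈ B, ∀ g ∈ A, ∀ h ∈ A, f g • h - f h • g ∈ A)
    (hA : ∃ G : Finset V, (G : Set V) ⊆ A ∧ PointedCone.hull ℝ (G : Set V) = ⊤)
    (S : Set (Dual ℝ V)) (hS : S.Finite) (hSB : S ⊆ B) :
    ∃ G : Finset V, (G : Set V) ⊆ A ∧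
      (PointedCone.hull ℝ (G : Set V) : Set V) = {x | ∀ f ∈ S, 0 ≤ f x} := by
  induction S, hS using Set.Finite.induction_on with
  | empty =>
    obtain ⟨G, hG, h⟩ := hA
    exact ⟨G, hG, by rw [h]; simp⟩
  | @insert f S _ _ ih =>
    obtain ⟨G, hG, h⟩ := ih ((Set.subset_insert _ _).trans hSB)
    obtain ⟨G', hG', h'⟩ := exists_hull_eq_inter_halfspace A f
      (hAB f (hSB (Set.mem_insert _ _))) G hG
    refine ⟨G', hG', Set.ext fun x => ?_⟩
    rw [SetLike.mem_coe, h', ← SetLike.mem_coe, h]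
    simp [and_comm]

/-- Fourier-Motzkin elimination: the sum of a polyhedral cone and a ray is polyhedral. -/
theorem exists_finite_ray_add (B : Set (Dual ℝ V)) (g : V)
    (hB : ∀ f ∈ B, ∀ h ∈ B, f g • h - h g • f ∈ B) (S : Set (Dual ℝ V)) (hS : S.Finite)
    (hSB : S ⊆ B) :
    ∃ S' : Set (Dual ℝ V), S'.Finite ∧ S' ⊆ B ∧
      ∀ x, (∀ f ∈ S', 0 ≤ f x) ↔ ∃ t : ℝ, 0 ≤ t ∧ ∀ f ∈ S, 0 ≤ f (x - t • g) := by
  set Sp := {f ∈ S | 0 ≤ f g} with hSp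
  set Sn := {f ∈ S | f g < 0} with hSn
  have hSpf : Sp.Finite := hS.subset fun f hf => hf.1
  have hSnf : Sn.Finite := hS.subset fun f hf => hf.1
  refine ⟨Sp ∪ Set.image2 (fun f h => f g • h - h g • f) Sp Sn, hSpf.union (hSpf.image2 _ hSnf),
    ?_, fun x => ⟨fun hx => ?_, ?_⟩⟩
  · rintro f (hf | ⟨a, ha, b, hb, rfl⟩)
    · exact hSB hf.1
    · exact hB _ (hSB ha.1) _ (hSB hb.1)
  · -- the largest of the lower bounds for `t`
    have hxp : ∀ f ∈ Sp, 0 ≤ f x := fun f hf => hx f (Or.inl hf)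
    have hxn : ∀ f ∈ Sp, ∀ h ∈ Sn, 0 ≤ f g * h x - h g * f x := fun f hf h hh =>
      hx _ (Or.inr ⟨f, hf, h, hh, rfl⟩)
    obtain ⟨t, ht0, htn, htp⟩ : ∃ t : ℝ, 0 ≤ t ∧ (∀ h ∈ Sn, h x / h g ≤ t) ∧
        ∀ f ∈ Sp, t * f g ≤ f x := by
      rcases Sn.eq_empty_or_nonempty with h0 | h0
      · exact ⟨0, le_rfl, by simp [h0], fun f hf => by simpa using hxp f hf⟩
      · obtain ⟨h, hh, hmax⟩ := Set.exists_max_image Sn (fun h => h x / h g) hSnf h0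
        refine ⟨max 0 (h x / h g), le_max_left _ _, fun k hk => (hmax k hk).trans
          (le_max_right _ _), fun f hf => ?_⟩
        rcases max_choice 0 (h x / h g) with e | e
        · rw [e, zero_mul]; exact hxp f hf
        · rw [e, div_mul_eq_mul_div, div_le_iff_of_neg hh.2]
          have := hxn f hf h hh
          nlinarith
    refine ⟨t, ht0, fun f hf => ?_⟩
    rw [map_sub, map_smul, smul_eq_mul, sub_nonneg]
    rcases le_or_gt 0 (f g) with h | h
    · exact htp f ⟨hf, h⟩
    · exact (div_le_iff_of_neg h).1 (htn f ⟨hf, h⟩)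
  · rintro ⟨t, ht, hx⟩
    simp only [map_sub, map_smul, smul_eq_mul, sub_nonneg] at hx
    rintro f (hf | ⟨a, ha, b, hb, rfl⟩)
    · exact (mul_nonneg ht hf.2).trans (hx f hf.1)
    · have h1 := mul_le_mul_of_nonneg_left (hx b hb.1) ha.2
      have h2 := mul_le_mul_of_nonneg_left (hx a ha.1) (neg_nonneg.2 hb.2.le)
      simp only [LinearMap.sub_apply, LinearMap.smul_apply, smul_eq_mul]
      nlinarith

/-- **Weyl's theorem** on finitely generated cones, keeping track of the field of definition of the
inequalities. -/
theorem exists_finite_eq_hull (A : Set V) (B : Set (Dual ℝ V))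
    (hAB : ∀ g ∈ A, ∀ f ∈ B, ∀ h ∈ B, f g • h - h g • f ∈ B)
    (hB : ∃ S ⊆ B, S.Finite ∧ {x : V | ∀ f ∈ S, 0 ≤ f x} = {0})
    (G : Finset V) (hG : (G : Set V) ⊆ A) :
    ∃ S ⊆ B, S.Finite ∧ (PointedCone.hull ℝ (G : Set V) : Set V) = {x | ∀ f ∈ S, 0 ≤ f x} := by
  classical
  induction G using Finset.induction_on with
  | empty =>
    obtain ⟨S, hS, hf, h⟩ := hB
    exact ⟨S, hS, hf, by rw [h]; simp⟩
  | insert g G hg ih =>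
    rw [Finset.coe_insert, Set.insert_subset_iff] at hG
    obtain ⟨S, hS, hf, h⟩ := ih hG.2
    obtain ⟨S', hS', hB', h'⟩ := exists_finite_ray_add B g (hAB g hG.1) S hf hS
    refine ⟨S', hB', hS', Set.ext fun x => ?_⟩
    rw [Set.mem_ofPred_eq, h', Finset.coe_insert, SetLike.mem_coe, PointedCone.hull,
      Submodule.mem_span_insert]
    constructor
    · rintro ⟨a, z, hz, rfl⟩
      refine ⟨a, a.2, fun f hf => ?_⟩
      have : z ∈ {x | ∀ f ∈ S, 0 ≤ f x} := h ▸ hz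
      have e : a • g + z - (a : ℝ) • g = z := by
        change (a : ℝ) • g + z - (a : ℝ) • g = z
        abel
      rw [e]; exact this f hf
    · rintro ⟨t, ht, hx⟩
      have : x - t • g ∈ (PointedCone.hull ℝ (G : Set V) : Set V) := h ▸ hx
      exact ⟨⟨t, ht⟩, x - t • g, this, by
        change x = t • g + (x - t • g)
        abel⟩

theorem hull_basis_eq_top {ι : Type*} [Fintype ι] [DecidableEq V] (b : Basis ι ℝ V) :
    PointedCone.hull ℝ
      ((Finset.univ.image b ∪ Finset.univ.image fun i => -b i : Finset V) : Set V) = ⊤ := by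
  refine eq_top_iff.2 fun x _ => ?_
  rw [← b.sum_repr x]
  refine Submodule.sum_mem _ fun i _ => ?_
  rcases le_total 0 (b.repr x i) with h | h
  · exact PointedCone.smul_mem _ h (PointedCone.subset_hull (by simp))
  · rw [← neg_smul_neg]
    exact PointedCone.smul_mem _ (neg_nonneg.2 h) (PointedCone.subset_hull (by simp))

/-- The start of the induction in Weyl's theorem, where the cone is generated by the empty set. The
inclusion of `S` keeps the forms rational when the basis is. -/
theorem exists_finite_eq_zero {ι : Type*} [Finite ι] (b : Basis ι ℝ V) :
    ∃ S ⊆ Set.range b.coord ∪ Set.range (fun i => -b.coord i), S.Finite ∧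
      {x : V | ∀ f ∈ S, 0 ≤ f x} = {0} := by
  refine ⟨_, subset_rfl, (Set.finite_range _).union (Set.finite_range _), Set.ext fun x => ?_⟩
  simp only [Set.mem_ofPred_eq, Set.mem_singleton_iff]
  constructor
  · intro h
    refine b.ext_elem fun i => ?_
    have h1 := h _ (Or.inl ⟨i, rfl⟩)
    have h2 := h _ (Or.inr ⟨i, rfl⟩)
    simp only [LinearMap.neg_apply, Basis.coord_apply] at h1 h2
    simpa using le_antisymm (by linarith) h1
  · rintro rfl
    simp

end PolyhedralCones

/-! ### Rational polyhedral cones. -/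

section RationalPolyhedralCones

variable {V : Type*} [NormedAddCommGroup V] [NormedSpace ℝ V]

section Rational

variable [Module ℚ V] {VQ : Submodule ℚ V}

theorem ratCast_smul_mem (q : ℚ) {v : V} (hv : v ∈ VQ) : (q : ℝ) • v ∈ VQ := by
  rw [Rat.cast_smul_eq_qsmul]
  exact VQ.smul_mem q hv

theorem IsRationalStructure.exists_coord_eq {b : Basis (Fin (finrank ℝ V)) ℝ V}
    {v : V} (hv : v ∈ Submodule.span ℚ (Set.range b)) (i : Fin (finrank ℝ V)) :
    ∃ q : ℚ, b.repr v i = q := by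
  induction hv using Submodule.span_induction with
  | mem x hx =>
    obtain ⟨j, rfl⟩ := hx
    exact ⟨if j = i then 1 else 0, by rw [b.repr_self, Finsupp.single_apply]; split_ifs <;> simp⟩
  | zero => exact ⟨0, by simp⟩
  | add x y _ _ hx hy =>
    obtain ⟨q, hq⟩ := hx
    obtain ⟨r, hr⟩ := hy
    exact ⟨q + r, by simp [hq, hr]⟩
  | smul a x _ hx =>
    obtain ⟨q, hq⟩ := hx
    exact ⟨a * q, by rw [← Rat.cast_smul_eq_qsmul ℝ]; simp [hq]⟩

theorem isRationalPolyhedralCone_hull (hVQ : IsRationalStructure VQ) (G : Finset V)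
    (hG : (G : Set V) ⊆ VQ) :
    IsRationalPolyhedralCone VQ (PointedCone.hull ℝ (G : Set V) : Set V) := by
  obtain ⟨b, hb⟩ := hVQ
  obtain ⟨S', hSB, hS', h0⟩ := exists_finite_eq_zero b
  obtain ⟨S, hr, hS, h⟩ := exists_finite_eq_hull (VQ : Set V)
    {f | ∀ v ∈ VQ, ∃ q : ℚ, f v = (q : ℝ)} (fun g hg f hf h hh v hv => by
      obtain ⟨q, hq⟩ := hf g hg
      obtain ⟨r, hr⟩ := hh g hg
      obtain ⟨q', hq'⟩ := hf v hv
      obtain ⟨r', hr'⟩ := hh v hv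
      exact ⟨q * r' - r * q', by simp [hq, hr, hq', hr']⟩)
    ⟨S', fun f hf v hv => by
      rw [hb] at hv
      rcases hSB hf with ⟨i, rfl⟩ | ⟨i, rfl⟩
      · exact IsRationalStructure.exists_coord_eq hv i
      · obtain ⟨q, hq⟩ := IsRationalStructure.exists_coord_eq hv i
        exact ⟨-q, by simp [hq]⟩, hS', h0⟩ G hG
  exact ⟨S, hS, hr, h⟩

theorem IsRationalPolyhedralCone.exists_hull_eq (hVQ : IsRationalStructure VQ) {P : Set V}
    (hP : IsRationalPolyhedralCone VQ P) :
    ∃ G : Finset V, (G : Set V) ⊆ VQ ∧ P = PointedCone.hull ℝ (G : Set V) := by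
  classical
  obtain ⟨b, hb⟩ := hVQ
  obtain ⟨S, hS, hr, rfl⟩ := hP
  obtain ⟨G, hG, h⟩ := exists_hull_eq_of_finite (VQ : Set V)
    {f | ∀ v ∈ VQ, ∃ q : ℚ, f v = (q : ℝ)} (fun f hf g hg h hh => by
      obtain ⟨q, hq⟩ := hf g hg
      obtain ⟨r, hr⟩ := hf h hh
      rw [hq, hr]
      exact VQ.sub_mem (ratCast_smul_mem _ hh) (ratCast_smul_mem _ hg))
    ⟨_, fun v hv => by
      have hbV : ∀ i, b i ∈ VQ := fun i => hb ▸ Submodule.subset_span ⟨i, rfl⟩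
      simp only [Finset.coe_union, Finset.coe_image, Finset.coe_univ, Set.image_univ] at hv
      rcases hv with ⟨i, rfl⟩ | ⟨i, rfl⟩
      · exact hbV i
      · exact VQ.neg_mem (hbV i), hull_basis_eq_top b⟩ S hS hr
  exact ⟨G, hG, h.symm⟩

end Rational

variable [FiniteDimensional ℝ V]

theorem IsPolyhedralCone.exists_hull_eq {P : Set V} (hP : IsPolyhedralCone P) :
    ∃ G : Finset V, P = PointedCone.hull ℝ (G : Set V) := by
  classical
  obtain ⟨S, hS, rfl⟩ := hP
  obtain ⟨G, -, hG⟩ := exists_hull_eq_of_finite Set.univ Set.univ (by simp)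
    ⟨_, Set.subset_univ _, hull_basis_eq_top (Module.finBasis ℝ V)⟩ S hS (Set.subset_univ _)
  exact ⟨G, hG.symm⟩

theorem isPolyhedralCone_hull (G : Finset V) :
    IsPolyhedralCone (PointedCone.hull ℝ (G : Set V) : Set V) := by
  obtain ⟨S', -, hS', h0⟩ := exists_finite_eq_zero (Module.finBasis ℝ V)
  obtain ⟨S, -, hS, h⟩ := exists_finite_eq_hull Set.univ Set.univ (by simp)
    ⟨S', Set.subset_univ _, hS', h0⟩ G (Set.subset_univ _)
  exact ⟨S, hS, h⟩

theorem IsPolyhedralCone.isClosed {P : Set V} (hP : IsPolyhedralCone P) : IsClosed P := by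
  obtain ⟨S, -, rfl⟩ := hP
  have : {x : V | ∀ f ∈ S, 0 ≤ f x} = ⋂ f ∈ S, {x | 0 ≤ f x} := by ext; simp
  rw [this]
  exact isClosed_biInter fun f _ =>
    isClosed_le continuous_const (LinearMap.continuous_of_finiteDimensional f)

end RationalPolyhedralCones

/-! ### Relative interiors and faces of convex cones. -/

section RelativeInterior

variable {V : Type*} [NormedAddCommGroup V] [NormedSpace ℝ V]

theorem IsConvexCone.add_mem {K : Set V} (hK : IsConvexCone K) {x y : V} (hx : x ∈ K)
    (hy : y ∈ K) : x + y ∈ K := by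
  have h := hK.smul_mem 2 two_pos _
    (hK.convex hx hy (by norm_num : (0 : ℝ) ≤ 1 / 2) (by norm_num : (0 : ℝ) ≤ 1 / 2) (by norm_num))
  have e : (2 : ℝ) • ((1 / 2 : ℝ) • x + (1 / 2 : ℝ) • y) = x + y := by module
  rwa [e] at h

theorem IsConvexCone.smul_mem_of_nonneg {K : Set V} (hK : IsConvexCone K) (h0 : 0 ∈ K) {c : ℝ}
    (hc : 0 ≤ c) {x : V} (hx : x ∈ K) : c • x ∈ K := by
  rcases hc.eq_or_lt with rfl | hc
  · rwa [zero_smul]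
  · exact hK.smul_mem c hc x hx

/-- A convex cone that contains the origin, as a pointed cone. -/
def IsConvexCone.toPointedCone {K : Set V} (hK : IsConvexCone K) (h0 : 0 ∈ K) :
    PointedCone ℝ V where
  carrier := K
  add_mem' := hK.add_mem
  zero_mem' := h0
  smul_mem' c _ hx := hK.smul_mem_of_nonneg h0 c.2 hx

theorem IsConvexCone.hull_subset {K : Set V} (hK : IsConvexCone K) (h0 : 0 ∈ K) {G : Set V}
    (hG : G ⊆ K) : (PointedCone.hull ℝ G : Set V) ⊆ K :=
  Submodule.span_le (p := hK.toPointedCone h0).2 hG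

theorem IsConvexCone.image {K : Set V} (hK : IsConvexCone K) (γ : V ≃ₗ[ℝ] V) :
    IsConvexCone (γ '' K) where
  nonempty := hK.nonempty.image _
  convex := hK.convex.linear_image γ.toLinearMap
  smul_mem := by
    rintro c hc _ ⟨x, hx, rfl⟩
    exact ⟨c • x, hK.smul_mem c hc x hx, by simp⟩

theorem IsConvexCone.intrinsicInterior_eq {K : Set V} (h0 : 0 ∈ K) :
    intrinsicInterior ℝ K =
      Subtype.val '' interior (Subtype.val ⁻¹' K : Set (Submodule.span ℝ K)) := by
  have h : affineSpan ℝ K = (Submodule.span ℝ K).toAffineSubspace := by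
    refine SetLike.coe_injective ?_
    rw [← Set.insert_eq_of_mem h0, affineSpan_insert_zero, Set.insert_eq_of_mem h0]
    rfl
  rw [intrinsicInterior, h]
  rfl

theorem IsConvexCone.preimage_intrinsicInterior {K : Set V} (h0 : 0 ∈ K) :
    (Subtype.val ⁻¹' intrinsicInterior ℝ K : Set (Submodule.span ℝ K)) =
      interior (Subtype.val ⁻¹' K) := by
  rw [IsConvexCone.intrinsicInterior_eq h0, Set.preimage_image_eq _ Subtype.val_injective]

/-- The face of the convex cone `K` generated by `x`. -/
def faceAt (K : Set V) (x : V) : Set V :=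
  {z | z ∈ K ∧ ∃ m : ℝ, 0 < m ∧ m • x - z ∈ K}

/-- In the order defined by `K`, `faceAt K x` consists of the elements of `K` below a multiple of
`x`. If `s • a + t • b` is below `m • x`, then `a` is below `(s⁻¹ * m) • x`. -/
theorem IsConvexCone.isFace_faceAt {K : Set V} (hK : IsConvexCone K) (h0 : 0 ∈ K) {x : V}
    (hx : x ∈ K) : IsFace (faceAt K x) K := by
  refine ⟨⟨x, hx, 1, one_pos, by simpa using h0⟩, ?_, fun z hz => hz.1, ?_⟩
  · rintro a ⟨ha, m, hm, hma⟩ b ⟨hb, n, hn, hnb⟩ s t hs ht hst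
    refine ⟨hK.convex ha hb hs ht hst, s * m + t * n, ?_, ?_⟩
    · rcases hs.eq_or_lt with rfl | hs
      · have : t = 1 := by linarith
        subst this; simpa using hn
      · positivity
    · have e : (s * m + t * n) • x - (s • a + t • b) = s • (m • x - a) + t • (n • x - b) := by module
      rw [e]
      exact hK.convex hma hnb hs ht hst
  · rintro a ha b hb z ⟨hz, m, hm, hmz⟩ hab
    obtain ⟨s, t, hs, ht, hst, rfl⟩ := hab
    refine ⟨ha, s⁻¹ * m, by positivity, ?_⟩
    have e : (s⁻¹ * m) • x - a = s⁻¹ • ((m • x - (s • a + t • b)) + t • b) := by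
      have : s⁻¹ • s • a = a := inv_smul_smul₀ hs.ne' a
      conv_lhs => rw [← this]
      module
    rw [e]
    exact hK.smul_mem _ (inv_pos.2 hs) _ (hK.add_mem hmz (hK.smul_mem t ht _ hb))

/-- An order-theoretic criterion that avoids topology later on. For the converse, subtract a small
multiple of a relatively interior point `y`: then `x` is the sum of an element of `K` and a positive
multiple of `y`. -/
theorem IsConvexCone.mem_intrinsicInterior_iff [FiniteDimensional ℝ V] {K : Set V}
    (hK : IsConvexCone K) (h0 : 0 ∈ K) {x : V} :
    x ∈ intrinsicInterior ℝ K ↔ x ∈ K ∧ ∀ y ∈ K, ∃ ε : ℝ, 0 < ε ∧ x - ε • y ∈ K := by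
  constructor
  · intro hx
    refine ⟨intrinsicInterior_subset hx, fun y hy => ?_⟩
    rw [IsConvexCone.intrinsicInterior_eq h0] at hx
    obtain ⟨x, hx, rfl⟩ := hx
    set y' : Submodule.span ℝ K := ⟨y, Submodule.subset_span hy⟩
    have hc : Filter.Tendsto (fun t : ℝ => x - t • y') (nhdsWithin 0 (Set.Ioi 0)) (nhds x) := by
      have : ContinuousAt (fun t : ℝ => x - t • y') 0 := by fun_prop
      simpa using this.tendsto.mono_left nhdsWithin_le_nhds
    obtain ⟨t, ht, ht0⟩ := ((hc.eventually (mem_interior_iff_mem_nhds.1 hx)).and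
      self_mem_nhdsWithin).exists
    exact ⟨t, ht0, ht⟩
  · rintro ⟨hx, h⟩
    obtain ⟨y, hy⟩ := Set.Nonempty.intrinsicInterior hK.convex hK.nonempty
    obtain ⟨ε, hε, hxy⟩ := h y (intrinsicInterior_subset hy)
    rw [IsConvexCone.intrinsicInterior_eq h0] at hy ⊢
    obtain ⟨y, hy, rfl⟩ := hy
    refine ⟨⟨x, Submodule.subset_span hx⟩, ?_, rfl⟩
    set x' : Submodule.span ℝ K := ⟨x, Submodule.subset_span hx⟩
    have hc : Continuous fun z : Submodule.span ℝ K => ε⁻¹ • (z - (x' - ε • y)) := by fun_prop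
    refine mem_interior.2 ⟨_ ⁻¹' interior (Subtype.val ⁻¹' K), ?_,
      isOpen_interior.preimage hc, ?_⟩
    · intro z hz
      have h1 : ((ε⁻¹ • (z - (x' - ε • y)) : Submodule.span ℝ K) : V) ∈ K :=
        interior_subset (s := (Subtype.val ⁻¹' K : Set (Submodule.span ℝ K))) hz
      have h2 := hK.add_mem (hK.smul_mem ε hε _ h1) hxy
      have e : ε • ((ε⁻¹ • (z - (x' - ε • y)) : Submodule.span ℝ K) : V) + (x - ε • (y : V)) = z := by
        simp only [Submodule.coe_smul, Submodule.coe_sub, smul_smul, mul_inv_cancel₀ hε.ne',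
          one_smul, x']
        abel
      rw [e] at h2
      exact h2
    · have e : ε⁻¹ • (x' - (x' - ε • y)) = y := by
        rw [sub_sub_cancel, smul_smul, inv_mul_cancel₀ hε.ne', one_smul]
      rw [Set.mem_preimage, e]
      exact hy

variable [FiniteDimensional ℝ V]

theorem IsConvexCone.image_intrinsicInterior {K : Set V} (hK : IsConvexCone K) (h0 : 0 ∈ K)
    (γ : V ≃ₗ[ℝ] V) : γ '' intrinsicInterior ℝ K = intrinsicInterior ℝ (γ '' K) := by
  ext x
  have h0' : (0 : V) ∈ γ '' K := ⟨0, h0, map_zero γ⟩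
  rw [(hK.image γ).mem_intrinsicInterior_iff h0']
  constructor
  · rintro ⟨x, hx, rfl⟩
    rw [hK.mem_intrinsicInterior_iff h0] at hx
    refine ⟨⟨x, hx.1, rfl⟩, ?_⟩
    rintro _ ⟨y, hy, rfl⟩
    obtain ⟨ε, hε, h⟩ := hx.2 y hy
    exact ⟨ε, hε, _, h, by simp⟩
  · rintro ⟨⟨x, hx, rfl⟩, h⟩
    refine ⟨x, (hK.mem_intrinsicInterior_iff h0).2 ⟨hx, fun y hy => ?_⟩, rfl⟩
    obtain ⟨ε, hε, z, hz, e⟩ := h (γ y) ⟨y, hy, rfl⟩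
    refine ⟨ε, hε, ?_⟩
    have : z = x - ε • y := γ.injective (by simp [e])
    rwa [← this]

theorem IsConvexCone.add_smul_mem_intrinsicInterior {K : Set V} (hK : IsConvexCone K) (h0 : 0 ∈ K)
    {x y : V} (hx : x ∈ K) (hy : y ∈ intrinsicInterior ℝ K) {t : ℝ} (ht : 0 < t) :
    x + t • y ∈ intrinsicInterior ℝ K := by
  rw [hK.mem_intrinsicInterior_iff h0] at hy ⊢
  refine ⟨hK.add_mem hx (hK.smul_mem t ht _ hy.1), fun z hz => ?_⟩
  obtain ⟨ε, hε, h⟩ := hy.2 z hz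
  refine ⟨t * ε, mul_pos ht hε, ?_⟩
  have e : x + t • y - (t * ε) • z = x + t • (y - ε • z) := by module
  rw [e]
  exact hK.add_mem hx (hK.smul_mem t ht _ h)

theorem IsConvexCone.smul_mem_intrinsicInterior {K : Set V} (hK : IsConvexCone K) (h0 : 0 ∈ K)
    {y : V} (hy : y ∈ intrinsicInterior ℝ K) {t : ℝ} (ht : 0 < t) :
    t • y ∈ intrinsicInterior ℝ K := by
  simpa using hK.add_smul_mem_intrinsicInterior h0 h0 hy ht

theorem IsConvexCone.sum_mem_intrinsicInterior {K : Set V} (hK : IsConvexCone K) (h0 : 0 ∈ K)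
    {F : Finset V} (hF : (F : Set V) ⊆ K) (hspan : K ⊆ Submodule.span ℝ (F : Set V)) :
    ∑ f ∈ F, f ∈ intrinsicInterior ℝ K := by
  have hsum : ∀ c : V → ℝ, (∀ f ∈ F, 0 ≤ c f) → ∑ f ∈ F, c f • f ∈ K := fun c hc =>
    (hK.toPointedCone h0).sum_mem fun f hf => hK.smul_mem_of_nonneg h0 (hc f hf) (hF hf)
  rw [hK.mem_intrinsicInterior_iff h0]
  refine ⟨by simpa using hsum 1 (by simp), fun y hy => ?_⟩
  obtain ⟨c, -, rfl⟩ := Submodule.mem_span_finset.1 (hspan hy)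
  -- The summand 1 only ensures that the bound on the coefficients is positive.
  obtain ⟨M, hM0, hM⟩ : ∃ M : ℝ, 0 < M ∧ ∀ f ∈ F, c f ≤ M :=
    ⟨1 + ∑ f ∈ F, |c f|, by positivity, fun f hf => (le_abs_self _).trans <|
      (Finset.single_le_sum (f := fun f => |c f|) (fun f _ => abs_nonneg _) hf).trans
        (by simp)⟩
  refine ⟨M⁻¹, inv_pos.2 hM0, ?_⟩
  have e : ∑ f ∈ F, f - M⁻¹ • ∑ f ∈ F, c f • f = ∑ f ∈ F, (1 - M⁻¹ * c f) • f := by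
    simp only [sub_smul, one_smul, Finset.sum_sub_distrib, Finset.smul_sum, smul_smul]
  rw [e]
  refine hsum _ fun f hf => ?_
  rw [sub_nonneg, inv_mul_le_iff₀ hM0, mul_one]
  exact hM f hf

theorem IsConvexCone.mem_intrinsicInterior_faceAt {K : Set V} (hK : IsConvexCone K) (h0 : 0 ∈ K)
    {x : V} (hx : x ∈ K) (hF : IsConvexCone (faceAt K x)) :
    x ∈ intrinsicInterior ℝ (faceAt K x) := by
  have h0F : (0 : V) ∈ faceAt K x := ⟨h0, 1, one_pos, by simpa using hx⟩
  refine (hF.mem_intrinsicInterior_iff h0F).2 ⟨⟨hx, 1, one_pos, by simpa using h0⟩, ?_⟩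
  rintro y ⟨hy, m, hm, hmy⟩
  refine ⟨m⁻¹, inv_pos.2 hm, ?_, 1, one_pos, ?_⟩
  · have := hK.smul_mem m⁻¹ (inv_pos.2 hm) _ hmy
    rwa [smul_sub, smul_smul, inv_mul_cancel₀ hm.ne', one_smul] at this
  · rw [one_smul, sub_sub_cancel]
    exact hK.smul_mem _ (inv_pos.2 hm) _ hy

theorem IsConvexCone.subset_faceAt {K σ : Set V} (hσ : IsConvexCone σ)
    (h0 : 0 ∈ σ) (hσK : σ ⊆ K) {x : V} (hx : x ∈ intrinsicInterior ℝ σ) : σ ⊆ faceAt K x := by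
  rw [hσ.mem_intrinsicInterior_iff h0] at hx
  intro y hy
  obtain ⟨ε, hε, h⟩ := hx.2 y hy
  refine ⟨hσK hy, ε⁻¹, inv_pos.2 hε, ?_⟩
  have := hσ.smul_mem ε⁻¹ (inv_pos.2 hε) _ h
  rw [smul_sub, smul_smul, inv_mul_cancel₀ hε.ne', one_smul] at this
  exact hσK this

end RelativeInterior

/-! ### Positive integral forms and lattice points of a closed salient cone. -/

section ConeLattice

variable {V : Type*} [NormedAddCommGroup V] [NormedSpace ℝ V]

/-- A closed salient convex cone together with a lattice. -/
structure IsConeLattice (K : PointedCone ℝ V) (L : Submodule ℤ V) : Prop where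
  isClosed : IsClosed (K : Set V)
  salient : ∀ x ∈ K, -x ∈ K → x = 0
  discrete : DiscreteTopology L
  span_eq_top : Submodule.span ℝ (L : Set V) = ⊤

/-- The linear forms that are integral on `L` and positive on `K` outside the origin. -/
def integralForms (K : PointedCone ℝ V) (L : Submodule ℤ V) : Set (Dual ℝ V) :=
  {η | (∀ l ∈ L, ∃ n : ℤ, η l = n) ∧ ∀ z ∈ K, z ≠ 0 → 0 < η z}

theorem nonneg_of_mem_integralForms {K : PointedCone ℝ V} {L : Submodule ℤ V} {η : Dual ℝ V}
    (hη : η ∈ integralForms K L) {z : V} (hz : z ∈ K) : 0 ≤ η z := by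
  rcases eq_or_ne z 0 with rfl | h
  · simp
  · exact (hη.2 z hz h).le

theorem exists_nat_mul_eq_int {ι : Type*} [Fintype ι] (q : ι → ℚ) :
    ∃ D : ℕ, 0 < D ∧ ∀ i, ∃ n : ℤ, (D : ℝ) * (q i : ℝ) = n := by
  refine ⟨∏ i, (q i).den, Finset.prod_pos fun i _ => (q i).pos, fun i => ?_⟩
  obtain ⟨k, hk⟩ := Finset.dvd_prod_of_mem (fun i => (q i).den) (Finset.mem_univ i)
  refine ⟨k * (q i).num, ?_⟩
  rw [hk]
  have h : ((q i).den : ℝ) * (q i : ℝ) = (q i).num := by exact_mod_cast Rat.den_mul_eq_num (q i)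
  push_cast
  rw [mul_right_comm, h, mul_comm]

theorem exists_rat_mem_of_isOpen {ι : Type*} [Finite ι] {U : Set (ι → ℝ)} (hU : IsOpen U)
    (hne : U.Nonempty) : ∃ q : ι → ℚ, (fun i => (q i : ℝ)) ∈ U := by
  have hd : DenseRange (Pi.map fun (_ : ι) (q : ℚ) => (q : ℝ)) :=
    DenseRange.piMap fun _ => Rat.denseRange_cast
  exact hd.exists_mem_open hU hne

variable [FiniteDimensional ℝ V]

theorem exists_basis_of_lattice (L : Submodule ℤ V) [DiscreteTopology L]
    (hL : Submodule.span ℝ (L : Set V) = ⊤) :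
    ∃ b : Basis (Fin (finrank ℝ V)) ℝ V, Submodule.span ℤ (Set.range b) = L := by
  have : IsZLattice ℝ L := ⟨hL⟩
  let b₀ := (Module.Free.chooseBasis ℤ L).ofZLatticeBasis ℝ L
  have hc : Nat.card (Module.Free.ChooseBasisIndex ℤ L) = finrank ℝ V :=
    (finrank_eq_nat_card_basis b₀).symm
  let e := (Finite.equivFinOfCardEq hc)
  refine ⟨b₀.reindex e, ?_⟩
  rw [Basis.range_reindex]
  exact (Module.Free.chooseBasis ℤ L).ofZLatticeBasis_span ℝ L

section

variable {K : PointedCone ℝ V}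

/-- For `x` in `K` of norm 1, salience gives `-x ∉ K`, and separating `-x` from `K` yields a form
that is nonnegative on `K` and positive near `x`. By compactness of the sphere, a finite sum of such
forms is positive everywhere on the slice. -/
theorem exists_continuous_pos (hK : IsClosed (K : Set V)) (hs : ∀ x ∈ K, -x ∈ K → x = 0) :
    ∃ f : V →L[ℝ] ℝ, ∀ x ∈ K, x ≠ 0 → 0 < f x := by
  have key : ∃ f : V →L[ℝ] ℝ, (∀ x ∈ K, 0 ≤ f x) ∧
      ∀ x ∈ Metric.sphere (0 : V) 1, x ∈ K → 0 < f x := by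
    refine (isCompact_sphere (0 : V) 1).induction_on
      (p := fun s => ∃ f : V →L[ℝ] ℝ, (∀ x ∈ K, 0 ≤ f x) ∧ ∀ x ∈ s, x ∈ K → 0 < f x)
      ⟨0, by simp, by simp⟩ ?_ ?_ ?_
    · rintro s t hst ⟨f, hf, hft⟩
      exact ⟨f, hf, fun x hx => hft x (hst hx)⟩
    · rintro s t ⟨f, hf, hfs⟩ ⟨g, hg, hgt⟩
      refine ⟨f + g, fun x hx => add_nonneg (hf x hx) (hg x hx), ?_⟩
      rintro x (hx | hx) hxK
      · exact add_pos_of_pos_of_nonneg (hfs x hx hxK) (hg x hxK)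
      · exact add_pos_of_nonneg_of_pos (hf x hxK) (hgt x hx hxK)
    · intro x hx
      have hx0 : x ≠ 0 := by rintro rfl; simp at hx
      by_cases hxK : x ∈ K
      · have hn : -x ∉ K := fun h => hx0 (hs x hxK h)
        obtain ⟨f, hf, hfx⟩ := ProperCone.hyperplane_separation_point ⟨K, hK⟩ hn
        refine ⟨{y | 0 < f y}, mem_nhdsWithin_of_mem_nhds ?_, f, fun x hx => hf x hx,
          fun y hy _ => hy⟩
        exact (isOpen_lt continuous_const f.continuous).mem_nhds (by simpa using hfx)
      · refine ⟨(K : Set V)ᶜ, mem_nhdsWithin_of_mem_nhds (hK.isOpen_compl.mem_nhds hxK), 0,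
          by simp, fun y hy hyK => absurd hyK hy⟩
  obtain ⟨f, -, hf⟩ := key
  refine ⟨f, fun x hx hx0 => ?_⟩
  have h := hf (‖x‖⁻¹ • x) (by simp [norm_smul, hx0]) (K.smul_mem (by positivity) hx)
  rw [map_smul, smul_eq_mul] at h
  exact (pos_iff_pos_of_mul_pos h).1 (by positivity)

theorem exists_mul_norm_le (hK : IsClosed (K : Set V)) {f : Dual ℝ V}
    (hf : ∀ x ∈ K, x ≠ 0 → 0 < f x) : ∃ δ : ℝ, 0 < δ ∧ ∀ x ∈ K, δ * ‖x‖ ≤ f x := by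
  have hc : IsCompact (Metric.sphere (0 : V) 1 ∩ K) := (isCompact_sphere _ _).inter_right hK
  have hfc : Continuous f := f.continuous_of_finiteDimensional
  rcases (Metric.sphere (0 : V) 1 ∩ K).eq_empty_or_nonempty with h0 | h0
  · refine ⟨1, one_pos, fun x hx => ?_⟩
    by_cases hx0 : x = 0
    · simp [hx0]
    · exact absurd h0 (Set.nonempty_iff_ne_empty.1
        ⟨‖x‖⁻¹ • x, by simp [norm_smul, hx0], K.smul_mem (by positivity) hx⟩)
  · obtain ⟨y, hy, hmin⟩ := hc.exists_isMinOn h0 hfc.continuousOn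
    have hy0 : y ≠ 0 := by rintro rfl; simp at hy
    refine ⟨f y, hf y hy.2 hy0, fun x hx => ?_⟩
    by_cases hx0 : x = 0
    · simp [hx0]
    · have h : f y ≤ f (‖x‖⁻¹ • x) := hmin (a := ‖x‖⁻¹ • x)
        ⟨by simp [norm_smul, hx0], K.smul_mem (by positivity) hx⟩
      rw [map_smul, smul_eq_mul, inv_mul_eq_div, le_div_iff₀ (norm_pos_iff.2 hx0)] at h
      exact h

theorem IsConeLattice.finite_le {L : Submodule ℤ V} (h : IsConeLattice K L) {f : Dual ℝ V}
    (hf : ∀ x ∈ K, x ≠ 0 → 0 < f x) (c : ℝ) : {z | z ∈ L ∧ z ∈ K ∧ f z ≤ c}.Finite := by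
  obtain ⟨δ, hδ, hle⟩ := exists_mul_norm_le h.isClosed hf
  have := h.discrete
  have hfin : (Metric.closedBall (0 : V) (c / δ) ∩ (L.toAddSubgroup : Set V)).Finite := by
    have : DiscreteTopology L.toAddSubgroup := h.discrete
    exact Metric.finite_isBounded_inter_isClosed DiscreteTopology.isDiscrete
      Metric.isBounded_closedBall inferInstance
  refine hfin.subset fun z hz => ⟨?_, hz.1⟩
  rw [mem_closedBall_zero_iff, le_div_iff₀ hδ, mul_comm]
  exact (hle z hz.2.1).trans hz.2.2

/-- Positivity on the compact unit slice of `K` is an open condition on the coefficients of a form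
in a lattice basis. So a positive form can be approximated by a rational one, and clearing
denominators makes it integral. -/
theorem IsConeLattice.integralForms_nonempty {L : Submodule ℤ V} (h : IsConeLattice K L) :
    (integralForms K L).Nonempty := by
  have := h.discrete
  obtain ⟨b, hb⟩ := exists_basis_of_lattice L h.span_eq_top
  obtain ⟨f, hf⟩ := exists_continuous_pos h.isClosed h.salient
  have hc : IsCompact (Metric.sphere (0 : V) 1 ∩ K) := (isCompact_sphere _ _).inter_right h.isClosed
  have hcoord : ∀ i, Continuous (b.coord i) := fun i => (b.coord i).continuous_of_finiteDimensional
  have hev : ∀ᶠ c : Fin (finrank ℝ V) → ℝ in nhds (fun i => f (b i)),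
      ∀ z ∈ Metric.sphere (0 : V) 1 ∩ K, 0 < ∑ i, c i * b.coord i z := by
    refine hc.eventually_forall_of_forall_eventually fun z hz => ?_
    have hcont : Continuous fun p : (Fin (finrank ℝ V) → ℝ) × V => ∑ i, p.1 i * b.coord i p.2 := by
      refine continuous_finsetSum _ fun i _ => ?_
      exact ((continuous_apply i).comp continuous_fst).mul ((hcoord i).comp continuous_snd)
    refine (isOpen_lt continuous_const hcont).mem_nhds ?_
    have hz0 : z ≠ 0 := by rintro rfl; simp at hz
    have e : ∑ i, f (b i) * b.coord i z = f z := by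
      conv_rhs => rw [← b.sum_repr z, map_sum]
      simp only [map_smul, smul_eq_mul, Basis.coord_apply, mul_comm]
    simpa only [Set.mem_ofPred_eq, e] using hf z hz.2 hz0
  obtain ⟨U, hU, hUo, hfU⟩ := mem_nhds_iff.1 hev
  obtain ⟨q, hq⟩ := exists_rat_mem_of_isOpen hUo ⟨_, hfU⟩
  obtain ⟨D, hD, hn⟩ := exists_nat_mul_eq_int q
  choose n hn using hn
  have hη : ∀ z, (∑ i, (n i : ℝ) • b.coord i) z = D * ∑ i, (q i : ℝ) * b.coord i z := by
    intro z
    simp only [LinearMap.sum_apply, LinearMap.smul_apply, smul_eq_mul, Finset.mul_sum, ← hn,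
      mul_assoc]
  refine ⟨∑ i, (n i : ℝ) • b.coord i, fun l hl => ?_, fun z hz hz0 => ?_⟩
  · rw [← hb] at hl
    induction hl using Submodule.span_induction with
    | mem x hx =>
      obtain ⟨j, rfl⟩ := hx
      exact ⟨n j, by simp [LinearMap.sum_apply, Finsupp.single_apply]⟩
    | zero => exact ⟨0, by simp⟩
    | add x y _ _ hx hy =>
      obtain ⟨k, hk⟩ := hx
      obtain ⟨m, hm⟩ := hy
      exact ⟨k + m, by rw [map_add, hk, hm]; push_cast; rfl⟩
    | smul a x _ hx =>
      obtain ⟨k, hk⟩ := hx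
      exact ⟨a * k, by rw [map_zsmul, hk]; simp⟩
  · have hpos := hU hq (‖z‖⁻¹ • z)
      ⟨by simp [norm_smul, hz0], K.smul_mem (by positivity) hz⟩
    have hpos' : 0 < (∑ i, (n i : ℝ) • b.coord i) (‖z‖⁻¹ • z) := by
      rw [hη]; exact mul_pos (by exact_mod_cast hD) hpos
    rw [map_smul, smul_eq_mul] at hpos'
    exact (pos_iff_pos_of_mul_pos hpos').1 (by positivity)

/-- Take a rational interior point `c`. For large `m` the points `c + (1 / (m + 1)) • b i` still lie
in `K`; together with `c` they span, and common multiples of them are lattice points. -/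
theorem IsConeLattice.exists_spanning {L : Submodule ℤ V} (h : IsConeLattice K L)
    (hint : (interior (K : Set V)).Nonempty) :
    ∃ B : Finset V, (∀ v ∈ B, v ∈ L ∧ v ∈ K) ∧ Submodule.span ℝ (B : Set V) = ⊤ := by
  classical
  have := h.discrete
  obtain ⟨b, hb⟩ := exists_basis_of_lattice L h.span_eq_top
  have hbL : ∀ i, b i ∈ L := fun i => hb ▸ Submodule.subset_span ⟨i, rfl⟩
  have hcont : Continuous fun c : Fin (finrank ℝ V) → ℝ => ∑ i, c i • b i := by fun_prop
  obtain ⟨q, hq⟩ := exists_rat_mem_of_isOpen (isOpen_interior.preimage hcont) <| by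
    obtain ⟨v, hv⟩ := hint
    exact ⟨b.repr v, by rw [Set.mem_preimage, b.sum_repr]; exact hv⟩
  obtain ⟨D, hD, hn⟩ := exists_nat_mul_eq_int q
  choose n hn using hn
  set c := ∑ i, (q i : ℝ) • b i with hc
  have hDc : D • c ∈ L := by
    have e : D • c = ∑ i, n i • b i := by
      rw [hc, Finset.smul_sum]
      refine Finset.sum_congr rfl fun i _ => ?_
      rw [← Int.cast_smul_eq_zsmul ℝ, ← hn, ← Nat.cast_smul_eq_nsmul ℝ, smul_smul]
    rw [e]
    exact L.sum_mem fun i _ => L.smul_mem _ (hbL i)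
  have hev : ∀ᶠ m : ℕ in Filter.atTop, ∀ i, c + (1 / ((m : ℝ) + 1)) • b i ∈ K := by
    refine Filter.eventually_all.2 fun i => ?_
    have ht : Filter.Tendsto (fun m : ℕ => c + (1 / ((m : ℝ) + 1)) • b i) Filter.atTop
        (nhds (c + (0 : ℝ) • b i)) :=
      (tendsto_one_div_add_atTop_nhds_zero_nat.smul_const (b i)).const_add c
    rw [zero_smul, add_zero] at ht
    exact ht.eventually (mem_interior_iff_mem_nhds.1 hq)
  obtain ⟨m, hm⟩ := hev.exists
  have hv : ∀ i, (D * (m + 1)) • c + D • b i ∈ K := fun i => by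
    have := K.smul_mem (r := (D : ℝ) * (m + 1)) (by positivity) (hm i)
    have e : ((D : ℝ) * (m + 1)) • (c + (1 / ((m : ℝ) + 1)) • b i) =
        (D * (m + 1)) • c + D • b i := by
      rw [smul_add, smul_smul, ← Nat.cast_smul_eq_nsmul ℝ, ← Nat.cast_smul_eq_nsmul ℝ]
      congr 2
      · push_cast; ring
      · field_simp
    rwa [e] at this
  refine ⟨insert (D • c) (Finset.univ.image fun i => (D * (m + 1)) • c + D • b i), ?_, ?_⟩
  · simp only [Finset.mem_insert, Finset.mem_image, Finset.mem_univ, true_and]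
    rintro _ (rfl | ⟨i, rfl⟩)
    · refine ⟨hDc, ?_⟩
      rw [← Nat.cast_smul_eq_nsmul ℝ]
      exact K.smul_mem (by positivity) (interior_subset hq)
    · refine ⟨L.add_mem ?_ (L.nsmul_mem (hbL i) D), hv i⟩
      rw [mul_comm, mul_smul]
      exact L.nsmul_mem hDc _
  · set W := Submodule.span ℝ ((insert (D • c) (Finset.univ.image fun i =>
      (D * (m + 1)) • c + D • b i) : Finset V) : Set V) with hW
    have h1 : D • c ∈ W := Submodule.subset_span (by simp)
    refine eq_top_iff.2 (b.span_eq.symm.le.trans (Submodule.span_le.2 ?_))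
    rintro _ ⟨i, rfl⟩
    have h2 : (D * (m + 1)) • c + D • b i ∈ W := Submodule.subset_span (by simp)
    have h3 : (D : ℝ) • b i ∈ W := by
      have e : (D : ℝ) • b i = (D * (m + 1)) • c + D • b i - (m + 1) • D • c := by
        rw [smul_smul, mul_comm (m + 1), Nat.cast_smul_eq_nsmul, add_sub_cancel_left]
      rw [e]
      exact W.sub_mem h2 (W.nsmul_mem h1 _)
    have := W.smul_mem (D : ℝ)⁻¹ h3
    rwa [inv_smul_smul₀ (by positivity)] at this

end

end ConeLattice

/-! ### Finiteness results for orbits of lattice points and of integral forms. -/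

section LatticeOrbits

variable {V : Type*} [NormedAddCommGroup V] [NormedSpace ℝ V]
variable {K : PointedCone ℝ V} {L : Submodule ℤ V} {Γ : Subgroup (V ≃ₗ[ℝ] V)}

/-- The lattice points of the order interval between `0` and `x`, for the order defined by `K`. -/
def latticeInterval (K : PointedCone ℝ V) (L : Submodule ℤ V) (x : V) : Set V :=
  {z | z ∈ L ∧ z ∈ K ∧ x - z ∈ K}

/-- Dickson's lemma: on a cone generated by lattice points, every integral positive form is bounded
below by one of finitely many of them. -/
theorem exists_finite_minimal_forms {G : Finset V} (hG : ∀ g ∈ G, g ∈ L ∧ g ∈ K) :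
    ∃ A : Set (Dual ℝ V), A.Finite ∧ A ⊆ integralForms K L ∧
      ∀ η ∈ integralForms K L, ∃ α ∈ A, ∀ g ∈ G, α g ≤ η g := by
  have hnat : ∀ η ∈ integralForms K L, ∃ φ : G → ℕ, ∀ g : G, η g = φ g := by
    intro η hη
    have : ∀ g : G, ∃ n : ℕ, η g = n := fun g => by
      obtain ⟨n, hn⟩ := hη.1 g (hG g g.2).1
      have h0 := nonneg_of_mem_integralForms hη (hG g g.2).2
      rw [hn] at h0
      obtain ⟨k, rfl⟩ := Int.eq_ofNat_of_zero_le (by exact_mod_cast h0 : 0 ≤ n)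
      exact ⟨k, by simpa using hn⟩
    exact ⟨fun g => (this g).choose, fun g => (this g).choose_spec⟩
  choose! φ hφ using hnat
  set T := φ '' integralForms K L
  -- The minimal elements form an antichain in a finite power of `ℕ`, which is well-quasi-ordered.
  have hT : {m | Minimal (· ∈ T) m}.Finite :=
    WellQuasiOrderedLE.finite_of_isAntichain (setOfPred_minimal_antichain _)
  have hmem : ∀ m ∈ {m | Minimal (· ∈ T) m}, ∃ η ∈ integralForms K L, φ η = m := fun m hm => hm.1
  choose! ψ hψ hψφ using hmem
  refine ⟨ψ '' {m | Minimal (· ∈ T) m}, hT.image ψ, ?_, fun η hη => ?_⟩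
  · rintro _ ⟨m, hm, rfl⟩
    exact hψ m hm
  · obtain ⟨m, hle, hm⟩ := exists_minimal_le_of_wellFoundedLT (· ∈ T) (φ η) ⟨η, hη, rfl⟩
    refine ⟨ψ m, ⟨m, hm, rfl⟩, fun g hg => ?_⟩
    have h1 := hφ (ψ m) (hψ m hm) ⟨g, hg⟩
    have h2 := hφ η hη ⟨g, hg⟩
    simp only at h1 h2
    rw [h1, h2, hψφ m hm]
    exact_mod_cast hle ⟨g, hg⟩

theorem le_on_hull {G : Finset V} {α η : Dual ℝ V} (h : ∀ g ∈ G, α g ≤ η g) {z : V}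
    (hz : z ∈ PointedCone.hull ℝ (G : Set V)) : α z ≤ η z := by
  obtain ⟨c, hc, rfl⟩ := mem_hull_finset.1 hz
  rw [map_sum, map_sum]
  refine Finset.sum_le_sum fun g hg => ?_
  rw [map_smul, map_smul]
  exact mul_le_mul_of_nonneg_left (h g hg) (hc g)

theorem finite_of_finite_orbits {B : Finset V} (hB : Submodule.span ℝ (B : Set V) = ⊤)
    {D : Set (V ≃ₗ[ℝ] V)} (hD : ∀ b ∈ B, {y | ∃ δ ∈ D, δ b = y}.Finite) : D.Finite := by
  have hfin : (Set.pi Set.univ fun b : B => {y | ∃ δ ∈ D, δ (b : V) = y}).Finite :=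
    Set.Finite.pi fun b => hD b b.2
  refine Set.Finite.of_finite_image (f := fun δ : V ≃ₗ[ℝ] V => fun b : B => δ b)
    (hfin.subset ?_) ?_
  · rintro _ ⟨δ, hδ, rfl⟩ b -
    exact ⟨δ, hδ, rfl⟩
  · intro δ _ ε _ h
    refine LinearEquiv.toLinearMap_injective (LinearMap.ext_on hB fun b hb => ?_)
    exact congrFun h ⟨b, hb⟩

/-- Finitely many nonzero forms are simultaneously nonzero on a positive combination of a spanning
set. -/
theorem exists_pos_combination_ne_zero {B : Finset V}
    (hB : Submodule.span ℝ (B : Set V) = ⊤) (F : Set (Dual ℝ V)) (hF : F.Finite)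
    (h0 : ∀ f ∈ F, f ≠ 0) :
    ∃ c : V → ℝ, (∀ b, 0 < c b) ∧ ∀ f ∈ F, f (∑ b ∈ B, c b • b) ≠ 0 := by
  classical
  induction F, hF using Set.Finite.induction_on with
  | empty => exact ⟨1, by simp, by simp⟩
  | @insert f F _ hFf ih =>
    obtain ⟨c, hc, hcF⟩ := ih fun f hf => h0 f (Set.mem_insert_of_mem _ hf)
    by_cases hf : f (∑ b ∈ B, c b • b) = 0
    · obtain ⟨b, hb, hfb⟩ : ∃ b ∈ B, f b ≠ 0 := by
        by_contra! hcon
        exact h0 f (Set.mem_insert _ _) (LinearMap.ext_on hB fun b hb => hcon b hb)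
      have hsum : ∀ (k : Dual ℝ V) (ε : ℝ), k (∑ v ∈ B, (c + Pi.single b ε : V → ℝ) v • v) =
          k (∑ v ∈ B, c v • v) + ε * k b := by
        intro k ε
        have : ∑ v ∈ B, (Pi.single b ε : V → ℝ) v • v = ε • b := by
          rw [Finset.sum_eq_single b]
          · simp
          · intro v _ hv; simp [Pi.single_eq_of_ne hv]
          · intro h; exact absurd hb h
        simp only [Pi.add_apply, add_smul, Finset.sum_add_distrib, this, map_add, map_smul,
          smul_eq_mul]
      -- A small perturbation of the coefficient of `b` preserves the finitely many conditions
      -- already achieved, and any nonzero one achieves the new condition.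
      have hev : ∀ᶠ ε in nhdsWithin (0 : ℝ) (Set.Ioi 0), ∀ k ∈ F,
          k (∑ v ∈ B, c v • v) + ε * k b ≠ 0 := by
        refine (Filter.eventually_all_finite hFf).2 fun k hk => ?_
        have hcont : ContinuousAt (fun ε : ℝ => k (∑ v ∈ B, c v • v) + ε * k b) 0 := by fun_prop
        refine (hcont.eventually_ne ?_).filter_mono nhdsWithin_le_nhds
        simpa using hcF k hk
      obtain ⟨ε, hε, hε0⟩ := (hev.and self_mem_nhdsWithin).exists
      refine ⟨c + Pi.single b ε, fun v => ?_, ?_⟩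
      · have : 0 ≤ (Pi.single b ε : V → ℝ) v := by
          rcases eq_or_ne v b with rfl | hv
          · simpa using (le_of_lt hε0)
          · simp [Pi.single_eq_of_ne hv]
        exact add_pos_of_pos_of_nonneg (hc v) this
      · rintro k (rfl | hk)
        · rw [hsum, hf, zero_add]
          exact mul_ne_zero (ne_of_gt hε0) hfb
        · rw [hsum]; exact hε k hk
    · refine ⟨c, hc, ?_⟩
      rintro k (rfl | hk)
      · exact hf
      · exact hcF k hk

variable [FiniteDimensional ℝ V]

theorem IsConeLattice.finite_latticeInterval (h : IsConeLattice K L) (x : V) :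
    (latticeInterval K L x).Finite := by
  obtain ⟨η, hη⟩ := h.integralForms_nonempty
  refine (h.finite_le hη.2 (η x)).subset fun z hz => ⟨hz.1, hz.2.1, ?_⟩
  have := nonneg_of_mem_integralForms hη hz.2.2
  rwa [map_sub, sub_nonneg] at this

/-- A cone generated by lattice points meets the orbit of a lattice point in a finite set. -/
theorem IsConeLattice.finite_orbit_inter_hull (h : IsConeLattice K L)
    (hΓK : ∀ γ ∈ Γ, ∀ x ∈ K, γ x ∈ K) (hΓL : ∀ γ ∈ Γ, ∀ x ∈ L, γ x ∈ L) {G : Finset V}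
    (hG : ∀ g ∈ G, g ∈ L ∧ g ∈ K) {x : V} (hxL : x ∈ L) (hxK : x ∈ K) :
    {y | (∃ γ ∈ Γ, γ x = y) ∧ y ∈ PointedCone.hull ℝ (G : Set V)}.Finite := by
  obtain ⟨η, hη⟩ := h.integralForms_nonempty
  set N := (latticeInterval K L x).ncard with hN
  refine (h.finite_le hη.2 (N * ∑ g ∈ G, η g)).subset ?_
  rintro _ ⟨⟨γ, hγ, rfl⟩, hy⟩
  refine ⟨hΓL γ hγ x hxL, hΓK γ hγ x hxK, ?_⟩
  obtain ⟨c, hc, hcy⟩ := mem_hull_finset.1 hy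
  -- The number of lattice points in the interval from 0 to `x` is constant along the orbit of `x`.
  have hcard : (latticeInterval K L (γ x)).ncard ≤ N := by
    refine Set.ncard_le_ncard_of_injOn (fun z => γ⁻¹ z) (fun z hz => ?_)
      (γ⁻¹ : V ≃ₗ[ℝ] V).injective.injOn (h.finite_latticeInterval x)
    have hγ' := Γ.inv_mem hγ
    refine ⟨hΓL _ hγ' z hz.1, hΓK _ hγ' z hz.2.1, ?_⟩
    have := hΓK _ hγ' _ hz.2.2
    rw [map_sub] at this
    have e : γ⁻¹ (γ x) = x := γ.symm_apply_apply x
    rwa [e] at this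
  -- The multiples `j • g` with `j ≤ c g` all lie in the interval from 0 to `γ x`, so the invariant
  -- count `N` bounds the coefficient `c g`. This bounds `η (γ x)` independently of `γ`.
  have hcN : ∀ g ∈ G, g ≠ 0 → c g ≤ N := by
    intro g hg hg0
    have hinj : Function.Injective fun j : ℕ => (j : ℝ) • g := fun i j hij => by
      exact_mod_cast smul_left_injective ℝ hg0 hij
    have hsub : (fun j : ℕ => (j : ℝ) • g) '' (Finset.range (⌊c g⌋₊ + 1) : Set ℕ) ⊆
        latticeInterval K L (γ x) := by
      rintro _ ⟨j, hj, rfl⟩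
      have hj' : (j : ℝ) ≤ c g :=
        (Nat.le_floor_iff (hc g)).1 (Nat.lt_succ_iff.1 (by simpa using hj))
      refine ⟨?_, K.smul_mem (by positivity) (hG g hg).2, ?_⟩
      · change (j : ℝ) • g ∈ L
        rw [Nat.cast_smul_eq_nsmul]
        exact L.nsmul_mem (hG g hg).1 j
      · classical
        change γ x - (j : ℝ) • g ∈ K
        rw [← hcy, ← Finset.add_sum_erase _ _ hg, add_sub_right_comm, ← sub_smul]
        exact K.add_mem (K.smul_mem (sub_nonneg.2 hj') (hG g hg).2) <| K.sum_mem fun k hk =>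
          K.smul_mem (hc k) (hG k (Finset.mem_of_mem_erase hk)).2
    have h1 := Set.ncard_le_ncard hsub (h.finite_latticeInterval _)
    rw [Set.ncard_image_of_injective _ hinj, Set.ncard_coe_finset, Finset.card_range] at h1
    have h2 : ((⌊c g⌋₊ : ℝ) + 1) ≤ N := by exact_mod_cast h1.trans hcard
    exact (Nat.lt_floor_add_one (c g)).le.trans h2
  rw [← hcy, map_sum, Finset.mul_sum]
  refine Finset.sum_le_sum fun g hg => ?_
  rw [map_smul, smul_eq_mul]
  rcases eq_or_ne g 0 with rfl | hg0
  · simp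
  · exact mul_le_mul_of_nonneg_right (hcN g hg hg0) (nonneg_of_mem_integralForms hη (hG g hg).2)

/-- Only finitely many elements of `Γ` relate two given positive integral forms. -/
theorem IsConeLattice.finite_transporter (h : IsConeLattice K L)
    (hint : (interior (K : Set V)).Nonempty)
    (hΓK : ∀ γ ∈ Γ, ∀ x ∈ K, γ x ∈ K) (hΓL : ∀ γ ∈ Γ, ∀ x ∈ L, γ x ∈ L)
    {α β : Dual ℝ V} (hα : α ∈ integralForms K L) :
    {δ : V ≃ₗ[ℝ] V | δ ∈ Γ ∧ ∀ v, α (δ v) = β v}.Finite := by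
  obtain ⟨B, hB, hspan⟩ := h.exists_spanning hint
  refine finite_of_finite_orbits hspan fun b hb => (h.finite_le hα.2 (β b)).subset ?_
  rintro _ ⟨δ, ⟨hδ, hδα⟩, rfl⟩
  exact ⟨hΓL δ hδ b (hB b hb).1, hΓK δ hδ b (hB b hb).2, (hδα b).le⟩

-- Here `s` is small in terms of `t`, so the sign is decided by the first nonzero entry among `a`,
-- `b`, `c`. The nested quantifiers record this order of choice.
open Filter Topology in
theorem eventually_lex_pos {a b c : ℝ} (h : 0 < a ∨ a = 0 ∧ (0 < b ∨ b = 0 ∧ 0 < c)) :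
    ∀ᶠ t in 𝓝[>] (0 : ℝ), ∀ᶠ s in 𝓝[>] (0 : ℝ), 0 < a + t * (b + s * c) := by
  have cont : ∀ t : ℝ, 0 < a + t * b → ∀ᶠ s in 𝓝[>] (0 : ℝ), 0 < a + t * (b + s * c) := by
    intro t ht
    have hcont : ContinuousAt (fun s : ℝ => a + t * (b + s * c)) 0 := by fun_prop
    exact (hcont.eventually_const_lt (by simpa using ht)).filter_mono nhdsWithin_le_nhds
  rcases h with h | ⟨rfl, h | ⟨rfl, h⟩⟩
  · have hcont : ContinuousAt (fun t : ℝ => a + t * b) 0 := by fun_prop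
    exact ((hcont.eventually_const_lt (by simpa using h)).filter_mono nhdsWithin_le_nhds).mono cont
  · filter_upwards [self_mem_nhdsWithin] with t ht
    exact cont t (by simpa using mul_pos ht h)
  · filter_upwards [self_mem_nhdsWithin] with t ht
    filter_upwards [self_mem_nhdsWithin] with s hs
    simpa using mul_pos ht (mul_pos hs h)

end LatticeOrbits

/-! ### Initial pieces of rational segments. -/

section Segments

variable {V : Type*} [NormedAddCommGroup V] [NormedSpace ℝ V]
variable {K : PointedCone ℝ V} {L : Submodule ℤ V} {Γ : Subgroup (V ≃ₗ[ℝ] V)}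

theorem comp_mem_integralForms (hΓK : ∀ γ ∈ Γ, ∀ x ∈ K, γ x ∈ K)
    (hΓL : ∀ γ ∈ Γ, ∀ x ∈ L, γ x ∈ L) {η : Dual ℝ V} (hη : η ∈ integralForms K L)
    {γ : V ≃ₗ[ℝ] V} (hγ : γ ∈ Γ) : η ∘ₗ γ.toLinearMap ∈ integralForms K L :=
  ⟨fun l hl => hη.1 _ (hΓL γ hγ l hl), fun z hz hz0 =>
    hη.2 _ (hΓK γ hγ z hz) (by simpa using hz0)⟩

/-- A lexicographic minimiser, among finitely many forms, of the values at three points of which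
the last one separates the forms. -/
theorem exists_lex_minimal {A : Set (Dual ℝ V)} (hA : A.Finite) (hne : A.Nonempty) (x y z : V)
    (hz : ∀ α ∈ A, ∀ β ∈ A, α ≠ β → α z ≠ β z) :
    ∃ η ∈ A, ∀ α ∈ A, α ≠ η → 0 < α x - η x ∨
      α x - η x = 0 ∧ (0 < α y - η y ∨ α y - η y = 0 ∧ 0 < α z - η z) := by
  obtain ⟨η, hη, hmin⟩ := Set.exists_min_image A
    (fun η => toLex (η x, toLex (η y, η z))) hA hne
  refine ⟨η, hη, fun α hα hne => ?_⟩
  have h := hmin α hα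
  simp only [Prod.Lex.toLex_le_toLex] at h
  rcases h with h | ⟨h, h'⟩
  · exact Or.inl (sub_pos.2 h)
  · refine Or.inr ⟨sub_eq_zero.2 h.symm, ?_⟩
    rcases h' with h' | ⟨h', h''⟩
    · exact Or.inl (sub_pos.2 h')
    · exact Or.inr ⟨sub_eq_zero.2 h'.symm,
        sub_pos.2 (lt_of_le_of_ne h'' (hz η hη α hα hne.symm))⟩

variable [FiniteDimensional ℝ V]

open Filter Topology in
/-- Near the starting point `x` of the segment from `x` towards `y`, a generic perturbation has a
unique minimising integral form. -/
theorem IsConeLattice.exists_unique_minimal_form (h : IsConeLattice K L)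
    (hint : (interior (K : Set V)).Nonempty) {x y : V} (hx : x ∈ L ∧ x ∈ K) (hy : y ∈ L ∧ y ∈ K) :
    ∃ (G : Finset V) (w : V), (∀ g ∈ G, g ∈ L ∧ g ∈ K) ∧
      x ∈ PointedCone.hull ℝ (G : Set V) ∧ y ∈ PointedCone.hull ℝ (G : Set V) ∧
      w ∈ PointedCone.hull ℝ (G : Set V) ∧
      ∃ η ∈ integralForms K L, ∀ᶠ t in 𝓝[>] (0 : ℝ), ∀ᶠ s in 𝓝[>] (0 : ℝ),
        ∀ α ∈ integralForms K L, α ≠ η → η (x + t • (y + s • w)) < α (x + t • (y + s • w)) := by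
  classical
  obtain ⟨B, hB, hspan⟩ := h.exists_spanning hint
  set G : Finset V := insert x (insert y B) with hGdef
  have hG : ∀ g ∈ G, g ∈ L ∧ g ∈ K := by
    intro g hg
    rw [hGdef, Finset.mem_insert, Finset.mem_insert] at hg
    rcases hg with rfl | rfl | hg
    exacts [hx, hy, hB g hg]
  obtain ⟨A, hAf, hAsub, hA⟩ := exists_finite_minimal_forms hG
  have hAne : A.Nonempty := by
    obtain ⟨η, hη⟩ := h.integralForms_nonempty
    obtain ⟨α, hα, -⟩ := hA η hη
    exact ⟨α, hα⟩
  -- The coefficients make `w` separate the finitely many forms of `A`, so that the lexicographic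
  -- minimiser at `x`, `y`, `w` is strict.
  obtain ⟨c, hc, hcne⟩ := exists_pos_combination_ne_zero hspan
    (Set.image2 (fun α β => α - β) A A \ {0}) ((hAf.image2 _ hAf).subset Set.sdiff_subset)
    (fun f hf => hf.2)
  set w := ∑ b ∈ B, c b • b with hw
  have hxG : x ∈ PointedCone.hull ℝ (G : Set V) := PointedCone.subset_hull (by simp [hGdef])
  have hyG : y ∈ PointedCone.hull ℝ (G : Set V) := PointedCone.subset_hull (by simp [hGdef])
  have hwG : w ∈ PointedCone.hull ℝ (G : Set V) := Submodule.sum_mem _ fun b hb =>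
    PointedCone.smul_mem _ (hc b).le (PointedCone.subset_hull (by simp [hGdef, hb]))
  obtain ⟨η, hη, hlex⟩ := exists_lex_minimal hAf hAne x y w fun α hα β hβ hne => by
    have := hcne (α - β) ⟨⟨α, hα, β, hβ, rfl⟩, sub_ne_zero.2 hne⟩
    rwa [LinearMap.sub_apply, sub_ne_zero] at this
  refine ⟨G, w, hG, hxG, hyG, hwG, η, hAsub hη, ?_⟩
  have hev : ∀ᶠ t in 𝓝[>] (0 : ℝ), ∀ α ∈ A, ∀ᶠ s in 𝓝[>] (0 : ℝ), α ≠ η →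
      η (x + t • (y + s • w)) < α (x + t • (y + s • w)) := by
    refine (eventually_all_finite hAf).2 fun α hα => ?_
    by_cases hne : α = η
    · simp [hne]
    · filter_upwards [eventually_lex_pos (hlex α hα hne)] with t ht
      filter_upwards [ht] with s hs _
      simp only [map_add, map_smul, smul_eq_mul]
      linarith
  filter_upwards [hev, self_mem_nhdsWithin] with t ht ht0
  filter_upwards [(eventually_all_finite hAf).2 ht, self_mem_nhdsWithin] with s hs hs0 α hα hne
  obtain ⟨β, hβ, hle⟩ := hA α hα
  have ht0' : (0 : ℝ) < t := ht0
  have hs0' : (0 : ℝ) < s := hs0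
  -- The finite set `A` controls every other form `α` through some `β ∈ A` below it. If `β = η`,
  -- strictness comes from `w`, a combination of the spanning set `B` with positive coefficients, on
  -- which two distinct comparable forms cannot agree. If `β ≠ η`, then `η` is already strictly
  -- below `β`.
  by_cases hβη : β = η
  · subst hβη
    have hlt : β w < α w := by
      rw [hw, map_sum, map_sum]
      simp only [map_smul, smul_eq_mul]
      refine Finset.sum_lt_sum (fun b hb => mul_le_mul_of_nonneg_left
        (hle b (by simp [hGdef, hb])) (hc b).le) ?_
      by_contra! hcon
      refine hne (LinearMap.ext_on hspan fun b hb => le_antisymm ?_ (hle b ?_))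
      · exact le_of_mul_le_mul_left (hcon b hb) (hc b)
      · simp only [hGdef, Finset.mem_insert]; exact Or.inr (Or.inr hb)
    have h1 := hle x (by simp [hGdef])
    have h2 := hle y (by simp [hGdef])
    simp only [map_add, map_smul, smul_eq_mul]
    have h3 : β y + s * β w < α y + s * α w := by nlinarith
    nlinarith
  · refine (hs β hβ hβη).trans_le (le_on_hull hle ?_)
    exact Submodule.add_mem _ hxG (PointedCone.smul_mem _ ht0'.le
      (Submodule.add_mem _ hyG (PointedCone.smul_mem _ hs0'.le hwG)))

open Filter Topology in
/-- If the translates of a finitely generated cone cover the cones generated by lattice points of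
`K`, then the initial piece of any rational segment lies in a translate of a fixed finitely
generated cone. -/
theorem IsConeLattice.exists_hull_segment (h : IsConeLattice K L)
    (hint : (interior (K : Set V)).Nonempty)
    (hΓK : ∀ γ ∈ Γ, ∀ x ∈ K, γ x ∈ K) (hΓL : ∀ γ ∈ Γ, ∀ x ∈ L, γ x ∈ L)
    {G₀ : Finset V} (hG₀ : ∀ g ∈ G₀, g ∈ L ∧ g ∈ K)
    (hcover : ∀ G : Finset V, (∀ g ∈ G, g ∈ L ∧ g ∈ K) →
      ∀ z ∈ PointedCone.hull ℝ (G : Set V), ∃ γ ∈ Γ, γ z ∈ PointedCone.hull ℝ (G₀ : Set V)) :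
    ∃ G : Finset V, (∀ g ∈ G, g ∈ L ∧ g ∈ K) ∧
      ∀ x, x ∈ L ∧ x ∈ K → ∀ y, y ∈ L ∧ y ∈ K → ∃ γ ∈ Γ, ∃ t : ℝ, 0 < t ∧
        γ x ∈ PointedCone.hull ℝ (G : Set V) ∧ γ (x + t • y) ∈ PointedCone.hull ℝ (G : Set V) := by
  classical
  obtain ⟨A, hAf, hAsub, hA⟩ := exists_finite_minimal_forms hG₀
  have hAne : A.Nonempty := by
    obtain ⟨η, hη⟩ := h.integralForms_nonempty
    obtain ⟨α, hα, -⟩ := hA η hη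
    exact ⟨α, hα⟩
  -- The possible discrepancies between two elements of `Γ` that carry the same form to members of
  -- `A`.
  set D : Set (V ≃ₗ[ℝ] V) :=
    ⋃ α ∈ A, ⋃ β ∈ A, {δ : V ≃ₗ[ℝ] V | δ ∈ Γ ∧ ∀ v, α (δ v) = β v} with hD
  have hDf : D.Finite := hAf.biUnion fun α hα => hAf.biUnion fun β _ =>
    h.finite_transporter hint hΓK hΓL (hAsub hα)
  have hDΓ : ∀ δ ∈ D, δ ∈ Γ := by
    intro δ hδ
    simp only [hD, Set.mem_iUnion] at hδ
    obtain ⟨α, -, β, -, hδ⟩ := hδ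
    exact hδ.1
  set G : Finset V := Finset.image₂ (fun δ g => δ g) hDf.toFinset G₀ with hGdef
  have hG : ∀ g ∈ G, g ∈ L ∧ g ∈ K := by
    intro g hg
    obtain ⟨δ, hδ, v, hv, rfl⟩ := Finset.mem_image₂.1 hg
    have := hDΓ δ (hDf.mem_toFinset.1 hδ)
    exact ⟨hΓL δ this v (hG₀ v hv).1, hΓK δ this v (hG₀ v hv).2⟩
  have hGmem : ∀ δ ∈ D, ∀ v ∈ PointedCone.hull ℝ (G₀ : Set V),
      δ v ∈ PointedCone.hull ℝ (G : Set V) := by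
    intro δ hδ v hv
    refine map_mem_hull_of_forall_mem δ (fun g hg => PointedCone.subset_hull ?_) hv
    exact_mod_cast Finset.mem_image₂_of_mem (hDf.mem_toFinset.2 hδ) hg
  refine ⟨G, hG, fun x hx y hy => ?_⟩
  obtain ⟨G', w, hG', hxG, hyG, hwG, η, hη, hmin⟩ := h.exists_unique_minimal_form hint hx hy
  -- a point with unique minimising form `η` can be moved into `hull G₀`
  have hmove : ∀ z ∈ PointedCone.hull ℝ (G' : Set V),
      (∀ α ∈ integralForms K L, α ≠ η → η z < α z) →
      ∃ γ ∈ Γ, γ z ∈ PointedCone.hull ℝ (G₀ : Set V) ∧ ∃ β ∈ A, ∀ v, β (γ v) = η v := by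
    intro z hz hηz
    obtain ⟨γ, hγ, hγz⟩ := hcover G' hG' z hz
    obtain ⟨β, hβ, hβle⟩ : ∃ β ∈ A, ∀ g ∈ integralForms K L, β (γ z) ≤ g (γ z) := by
      obtain ⟨β, hβ, hβmin⟩ := Set.exists_min_image A (fun α => α (γ z)) hAf hAne
      refine ⟨β, hβ, fun g hg => ?_⟩
      obtain ⟨α, hα, hle⟩ := hA g hg
      exact (hβmin α hα).trans (le_on_hull hle hγz)
    refine ⟨γ, hγ, hγz, β, hβ, fun v => ?_⟩
    -- The form `β` is minimal at `γ z` among all integral forms, so its pullback is minimal at `z`,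
    -- where `η` is the only minimiser.
    have heq : β ∘ₗ γ.toLinearMap = η := by
      by_contra hne
      have h1 := hηz _ (comp_mem_integralForms hΓK hΓL (hAsub hβ) hγ) hne
      have h2 := hβle _ (comp_mem_integralForms hΓK hΓL hη (Γ.inv_mem hγ))
      have e : γ⁻¹ (γ z) = z := γ.symm_apply_apply z
      simp only [LinearMap.comp_apply, LinearEquiv.coe_coe, e] at h1 h2
      exact absurd h2 (not_le.2 h1)
    exact LinearMap.congr_fun heq v
  have hzG : ∀ t s : ℝ, 0 < t → 0 < s → x + t • (y + s • w) ∈ PointedCone.hull ℝ (G' : Set V) :=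
    fun t s ht hs => Submodule.add_mem _ hxG (PointedCone.smul_mem _ ht.le
      (Submodule.add_mem _ hyG (PointedCone.smul_mem _ hs.le hwG)))
  have hgood : ∀ᶠ t in 𝓝[>] (0 : ℝ), ∀ᶠ s in 𝓝[>] (0 : ℝ),
      ∃ γ ∈ Γ, γ (x + t • (y + s • w)) ∈ PointedCone.hull ℝ (G₀ : Set V) ∧
        ∃ β ∈ A, ∀ v, β (γ v) = η v := by
    filter_upwards [hmin, self_mem_nhdsWithin] with t ht ht0
    filter_upwards [ht, self_mem_nhdsWithin] with s hs hs0
    exact hmove _ (hzG t s ht0 hs0) hs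
  obtain ⟨t₀, ht₀⟩ := hgood.exists
  obtain ⟨s₀, γ₀, hγ₀, -, β₀, hβ₀, hβη₀⟩ := ht₀.exists
  -- Fix one element `γ₀`. The element that serves at another parameter differs from it by a member
  -- of `D`, so `γ₀` itself works throughout once `hull G₀` is enlarged to `hull G`.
  have hin : ∀ᶠ t in 𝓝[>] (0 : ℝ), ∀ᶠ s in 𝓝[>] (0 : ℝ),
      γ₀ (x + t • (y + s • w)) ∈ PointedCone.hull ℝ (G : Set V) := by
    filter_upwards [hgood] with t ht
    filter_upwards [ht] with s hs
    obtain ⟨γ, hγ, hγz, β, hβ, hβη⟩ := hs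
    have hδ : γ₀ * γ⁻¹ ∈ D := by
      simp only [hD, Set.mem_iUnion]
      refine ⟨β₀, hβ₀, β, hβ, Γ.mul_mem hγ₀ (Γ.inv_mem hγ), fun v => ?_⟩
      have e : γ (γ⁻¹ v) = v := γ.apply_symm_apply v
      rw [LinearEquiv.mul_apply, hβη₀, ← hβη, e]
    have := hGmem _ hδ _ hγz
    have e : γ⁻¹ (γ (x + t • (y + s • w))) = x + t • (y + s • w) := γ.symm_apply_apply _
    rwa [LinearEquiv.mul_apply, e] at this
  have hγc : Continuous γ₀ := γ₀.toLinearMap.continuous_of_finiteDimensional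
  have hcl := (isPolyhedralCone_hull G).isClosed
  have hlim : ∀ᶠ t in 𝓝[>] (0 : ℝ), γ₀ (x + t • y) ∈ PointedCone.hull ℝ (G : Set V) := by
    filter_upwards [hin] with t ht
    have hc : Continuous fun s : ℝ => γ₀ (x + t • (y + s • w)) := by fun_prop
    have ht' : Tendsto (fun s : ℝ => γ₀ (x + t • (y + s • w))) (𝓝[>] 0) (𝓝 (γ₀ (x + t • y))) := by
      simpa using (hc.tendsto 0).mono_left nhdsWithin_le_nhds
    exact hcl.mem_of_tendsto ht' ht
  have hx' : γ₀ x ∈ PointedCone.hull ℝ (G : Set V) := by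
    have hc : Continuous fun t : ℝ => γ₀ (x + t • y) := by fun_prop
    have ht' : Tendsto (fun t : ℝ => γ₀ (x + t • y)) (𝓝[>] 0) (𝓝 (γ₀ x)) := by
      simpa using (hc.tendsto 0).mono_left nhdsWithin_le_nhds
    exact hcl.mem_of_tendsto ht' hlim
  obtain ⟨t, ht, ht0⟩ := (hlim.and self_mem_nhdsWithin).exists
  exact ⟨γ₀, hγ₀, t, ht0, hx', ht⟩

end Segments

/-! ### The rational hull of a cone, and the data extracted from a triple of polyhedral type. -/

section RationalHull

variable {V : Type*} [NormedAddCommGroup V] [NormedSpace ℝ V]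

theorem IsConvexCone.closure {C : Set V} (hC : IsConvexCone C) :
    IsConvexCone (_root_.closure C) where
  nonempty := hC.nonempty.closure
  convex := hC.convex.closure
  smul_mem c hc _ hx :=
    map_mem_closure (continuous_const_smul c) hx fun y hy => hC.smul_mem c hc y hy

theorem IsConvexCone.zero_mem_closure {C : Set V} (hC : IsConvexCone C) :
    (0 : V) ∈ _root_.closure C := by
  obtain ⟨x, hx⟩ := hC.nonempty
  have hc : Continuous fun t : ℝ => t • x := by fun_prop
  have ht : Filter.Tendsto (fun t : ℝ => t • x) (nhdsWithin 0 (Set.Ioi 0)) (nhds 0) := by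
    simpa using (hc.tendsto 0).mono_left nhdsWithin_le_nhds
  refine mem_closure_of_tendsto ht ?_
  filter_upwards [self_mem_nhdsWithin] with t ht
  exact hC.smul_mem t ht x hx

/-- The closure of an open nondegenerate convex cone is salient. -/
theorem IsConvexCone.eq_zero_of_neg_mem_closure {C : Set V} (hC : IsConvexCone C) (ho : IsOpen C)
    (hn : IsNondegenerate C) {v : V} (hv : v ∈ _root_.closure C) (hv' : -v ∈ _root_.closure C) :
    v = 0 := by
  by_contra hv0
  obtain ⟨c, hc⟩ := hC.nonempty
  obtain ⟨t, ht⟩ := hn c v hv0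
  have key : ∀ w ∈ _root_.closure C, c + w ∈ C := by
    intro w hw
    have h := hC.convex.openSegment_interior_closure_subset_interior
      (ho.interior_eq.symm ▸ hc : c ∈ interior C) hw
    have h2 : (1 / 2 : ℝ) • c + (1 / 2 : ℝ) • w ∈ interior C :=
      h ⟨1 / 2, 1 / 2, by norm_num, by norm_num, by norm_num, rfl⟩
    have h3 := hC.smul_mem 2 two_pos _ (interior_subset h2)
    have e : (2 : ℝ) • ((1 / 2 : ℝ) • c + (1 / 2 : ℝ) • w) = c + w := by module
    rwa [e] at h3
  refine ht (key _ ?_)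
  rcases le_total 0 t with h | h
  · exact hC.closure.smul_mem_of_nonneg hC.zero_mem_closure h hv
  · have := hC.closure.smul_mem_of_nonneg hC.zero_mem_closure (neg_nonneg.2 h) hv'
    rwa [neg_smul_neg] at this

variable [Module ℚ V] {VQ : Submodule ℚ V}

/-- A rational vector in the real span of a set of rational vectors lies in its rational span. -/
theorem IsRationalStructure.mem_span_rat (hVQ : IsRationalStructure VQ) {W : Set V} (hW : W ⊆ VQ)
    {v : V} (hv : v ∈ VQ) (hvW : v ∈ Submodule.span ℝ W) : v ∈ Submodule.span ℚ W := by
  by_contra hcon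
  obtain ⟨b, hb⟩ := hVQ
  obtain ⟨π, hπv, hπ⟩ := Submodule.exists_le_ker_of_notMem hcon
  -- A rational functional that vanishes on `W` but not at `v` extends to a real one, because `VQ`
  -- is spanned over `ℚ` by a real basis.
  set φ : V →ₗ[ℝ] ℝ := b.constr ℝ fun i => (π (b i) : ℝ) with hφ
  have hφπ : ∀ w ∈ VQ, φ w = π w := by
    intro w hw
    rw [hb] at hw
    induction hw using Submodule.span_induction with
    | mem x hx =>
      obtain ⟨i, rfl⟩ := hx
      rw [hφ, b.constr_basis]
    | zero => simp
    | add x y _ _ hx hy => rw [map_add, map_add, hx, hy, Rat.cast_add]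
    | smul a x _ hx =>
      have e : (a : ℝ) • x = a • x := Rat.cast_smul_eq_qsmul ℝ a x
      rw [← e, map_smul, hx, e, map_smul]
      simp
  have h0 : φ v = 0 := by
    have hle : Submodule.span ℝ W ≤ LinearMap.ker φ := Submodule.span_le.2 fun w hw => by
      have : π w = 0 := hπ (Submodule.subset_span hw)
      rw [SetLike.mem_coe, LinearMap.mem_ker, hφπ w (hW hw), this, Rat.cast_zero]
    exact hle hvW
  rw [hφπ v hv] at h0
  exact hπv (by exact_mod_cast h0)

theorem exists_nsmul_mem_of_mem_span_rat {L : Submodule ℤ V} {v : V}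
    (hv : v ∈ Submodule.span ℚ (L : Set V)) : ∃ m : ℕ, 0 < m ∧ m • v ∈ L := by
  induction hv using Submodule.span_induction with
  | mem x hx => exact ⟨1, one_pos, by simpa using hx⟩
  | zero => exact ⟨1, one_pos, by simp⟩
  | add x y _ _ hx hy =>
    obtain ⟨m, hm, hmx⟩ := hx
    obtain ⟨n, hn, hny⟩ := hy
    refine ⟨m * n, Nat.mul_pos hm hn, ?_⟩
    rw [smul_add]
    refine L.add_mem ?_ ?_
    · rw [mul_comm, mul_smul]; exact L.nsmul_mem hmx n
    · rw [mul_smul]; exact L.nsmul_mem hny m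
  | smul q x _ hx =>
    obtain ⟨m, hm, hmx⟩ := hx
    refine ⟨q.den * m, Nat.mul_pos q.pos hm, ?_⟩
    have e : (q.den * m) • q • x = q.num • m • x := by
      rw [← Rat.cast_smul_eq_qsmul ℝ, ← Nat.cast_smul_eq_nsmul ℝ, ← Int.cast_smul_eq_zsmul ℝ,
        ← Nat.cast_smul_eq_nsmul ℝ m, smul_smul, smul_smul]
      congr 1
      have h : ((q.den : ℝ)) * (q : ℝ) = q.num := by exact_mod_cast Rat.den_mul_eq_num q
      push_cast
      rw [mul_right_comm, h]
    rw [e]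
    exact L.smul_mem _ hmx

theorem subset_rationalHull {C : Set V} : closure C ∩ VQ ⊆ rationalHull VQ C :=
  subset_convexHull ℝ _

theorem IsConvexCone.zero_mem_rationalHull {C : Set V} (hC : IsConvexCone C) :
    (0 : V) ∈ rationalHull VQ C :=
  subset_rationalHull ⟨hC.zero_mem_closure, VQ.zero_mem⟩

/-- `VQ` is stable only under rational scalars, so for real `c` the point `c • r` is obtained by
convexity, between 0 and `n • r` with `n` a natural number above `c`. -/
theorem IsConvexCone.rationalHull {C : Set V} (hC : IsConvexCone C) :
    IsConvexCone (rationalHull VQ C) where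
  nonempty := ⟨0, hC.zero_mem_rationalHull⟩
  convex := convex_convexHull ℝ _
  smul_mem c hc x hx := by
    have hconv : Convex ℝ ((fun x : V => c • x) ⁻¹' _root_.rationalHull VQ C) :=
      (convex_convexHull ℝ _).linear_preimage (c • LinearMap.id : V →ₗ[ℝ] V)
    refine convexHull_min ?_ hconv hx
    rintro r ⟨hrC, hrQ⟩
    obtain ⟨n, hn⟩ := exists_nat_gt c
    have hn0 : (0 : ℝ) < n := hc.trans hn
    have hnr : (n : ℝ) • r ∈ _root_.rationalHull VQ C := by
      refine subset_rationalHull ⟨hC.closure.smul_mem _ hn0 r hrC, ?_⟩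
      have := ratCast_smul_mem (VQ := VQ) (n : ℚ) hrQ
      simpa using this
    have h := (convex_convexHull ℝ (_root_.closure C ∩ (VQ : Set V)))
      hC.zero_mem_rationalHull hnr (a := 1 - c / n) (b := c / n)
      (sub_nonneg.2 ((div_le_one hn0).2 hn.le)) (by positivity) (by ring)
    rwa [smul_zero, zero_add, smul_smul, div_mul_cancel₀ _ hn0.ne'] at h

theorem IsConvexCone.mem_rationalHull_iff {C : Set V} (hC : IsConvexCone C) {L : Submodule ℤ V}
    (hLQ : ∀ l ∈ L, l ∈ VQ) (hQL : ∀ v ∈ VQ, ∃ m : ℕ, 0 < m ∧ m • v ∈ L) {z : V} :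
    z ∈ _root_.rationalHull VQ C ↔ ∃ G : Finset V, (∀ g ∈ G, g ∈ L ∧ g ∈ _root_.closure C) ∧
      z ∈ PointedCone.hull ℝ (G : Set V) := by
  classical
  constructor
  · intro hz
    refine convexHull_min (t := {z | ∃ G : Finset V, (∀ g ∈ G, g ∈ L ∧ g ∈ _root_.closure C) ∧
      z ∈ PointedCone.hull ℝ (G : Set V)}) ?_ ?_ hz
    · rintro r ⟨hrC, hrQ⟩
      obtain ⟨m, hm, hmr⟩ := hQL r hrQ
      have hm0 : (0 : ℝ) < m := by exact_mod_cast hm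
      refine ⟨{m • r}, ?_, ?_⟩
      · simp only [Finset.mem_singleton, forall_eq]
        refine ⟨hmr, ?_⟩
        rw [← Nat.cast_smul_eq_nsmul ℝ]
        exact hC.closure.smul_mem _ hm0 r hrC
      · have h1 : m • r ∈ PointedCone.hull ℝ (({m • r} : Finset V) : Set V) :=
          PointedCone.subset_hull (by simp)
        have h2 := PointedCone.smul_mem _ (inv_nonneg.2 hm0.le) h1
        have e : (m : ℝ)⁻¹ • m • r = r := by
          rw [← Nat.cast_smul_eq_nsmul ℝ, inv_smul_smul₀ hm0.ne']
        rwa [e] at h2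
    · rintro x ⟨G, hG, hx⟩ y ⟨G', hG', hy⟩ s t hs ht _
      refine ⟨G ∪ G', fun g hg => (Finset.mem_union.1 hg).elim (hG g) (hG' g), ?_⟩
      refine Submodule.add_mem _ (PointedCone.smul_mem _ hs ?_) (PointedCone.smul_mem _ ht ?_)
      · exact Submodule.span_mono (by simp) hx
      · exact Submodule.span_mono (by simp) hy
  · rintro ⟨G, hG, hz⟩
    exact hC.rationalHull.hull_subset hC.zero_mem_rationalHull
      (fun g hg => subset_rationalHull ⟨(hG g hg).2, hLQ g (hG g hg).1⟩) hz

variable [FiniteDimensional ℝ V]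

/-- The data extracted from a triple of polyhedral type: the closure `K` of the cone, an invariant
lattice `L`, the cone `X = C₊`, and a finitely generated cone whose translates cover `X`. -/
structure IsReductionDatum (VQ : Submodule ℚ V) (X : Set V) (K : PointedCone ℝ V)
    (L : Submodule ℤ V) (Γ : Subgroup (V ≃ₗ[ℝ] V)) (G₀ : Finset V) : Prop where
  isRationalStructure : IsRationalStructure VQ
  isConeLattice : IsConeLattice K L
  interior_nonempty : (interior (K : Set V)).Nonempty
  rational : ∀ l ∈ L, l ∈ VQ
  exists_nsmul_mem : ∀ v ∈ VQ, ∃ m : ℕ, 0 < m ∧ m • v ∈ L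
  map_cone : ∀ γ ∈ Γ, ∀ x ∈ K, γ x ∈ K
  map_lattice : ∀ γ ∈ Γ, ∀ x ∈ L, γ x ∈ L
  isConvexCone : IsConvexCone X
  mem_iff : ∀ z, z ∈ X ↔ ∃ G : Finset V, (∀ g ∈ G, g ∈ L ∧ g ∈ K) ∧
    z ∈ PointedCone.hull ℝ (G : Set V)
  generators_mem : ∀ g ∈ G₀, g ∈ L ∧ g ∈ K
  cover : ∀ z ∈ X, ∃ γ ∈ Γ, γ z ∈ PointedCone.hull ℝ (G₀ : Set V)

/-- The given polyhedral cone need not be rational. Each of its finitely many generators lies in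
`C₊`, hence in a cone generated by lattice points of the closure of `C`; collecting all these
lattice points gives a larger rational cone that is still inside `C₊`. -/
theorem IsPolyhedralTriple.exists_isReductionDatum {C : Set V} {Γ : Subgroup (V ≃ₗ[ℝ] V)}
    (h : IsPolyhedralTriple VQ C Γ) :
    ∃ (K : PointedCone ℝ V) (L : Submodule ℤ V) (G₀ : Finset V),
      (K : Set V) = closure C ∧ IsReductionDatum VQ (rationalHull VQ C) K L Γ G₀ := by
  classical
  have hC := h.isConvexCone
  obtain ⟨L, ⟨hLQ, hLd, hLs⟩, hΓL⟩ := h.exists_lattice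
  obtain ⟨P, hP, hPX, hPc⟩ := h.exists_cone
  have hQL : ∀ v ∈ VQ, ∃ m : ℕ, 0 < m ∧ m • v ∈ L := fun v hv =>
    exists_nsmul_mem_of_mem_span_rat
      (h.isRationalStructure.mem_span_rat (W := (L : Set V)) hLQ hv (by rw [hLs]; trivial))
  have hmem := fun z => hC.mem_rationalHull_iff (z := z) hLQ hQL
  obtain ⟨H, rfl⟩ := hP.exists_hull_eq
  have hH : ∀ g ∈ H, ∃ G : Finset V, (∀ g ∈ G, g ∈ L ∧ g ∈ closure C) ∧
      g ∈ PointedCone.hull ℝ (G : Set V) := fun g hg =>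
    (hmem g).1 (hPX (PointedCone.subset_hull hg))
  choose! G hG hgG using hH
  refine ⟨hC.closure.toPointedCone hC.zero_mem_closure, L, H.biUnion G, rfl,
    h.isRationalStructure, ⟨isClosed_closure, fun x hx hx' =>
      hC.eq_zero_of_neg_mem_closure h.isOpen h.isNondegenerate hx hx', hLd, hLs⟩,
    ?_, hLQ, hQL, ?_, ?_, hC.rationalHull, hmem, ?_, ?_⟩
  · exact hC.nonempty.mono (interior_maximal subset_closure h.isOpen)
  · intro γ hγ x hx
    refine map_mem_closure γ.toLinearMap.continuous_of_finiteDimensional hx fun y hy => ?_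
    rw [← h.image_eq γ hγ]
    exact ⟨y, hy, rfl⟩
  · intro γ hγ x hx
    rw [← SetLike.mem_coe, ← hΓL γ hγ]
    exact ⟨x, hx, rfl⟩
  · intro g hg
    obtain ⟨k, hk, hg⟩ := Finset.mem_biUnion.1 hg
    exact hG k hk g hg
  · intro z hz
    rw [← hPc] at hz
    simp only [Set.mem_iUnion] at hz
    obtain ⟨γ, hγ, w, hw, rfl⟩ := hz
    refine ⟨γ⁻¹, Γ.inv_mem hγ, ?_⟩
    have e : γ⁻¹ (γ w) = w := γ.symm_apply_apply w
    rw [e]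
    refine Submodule.span_le.2 (fun g hg => ?_) hw
    exact Submodule.span_mono (Finset.coe_subset.2 (Finset.subset_biUnion_of_mem G hg)) (hgG g hg)

end RationalHull

/-! ### Pointwise stabilizers and their orbits on stars. -/

section Groups

variable {V : Type*} [NormedAddCommGroup V] [NormedSpace ℝ V]
variable {Γ : Subgroup (V ≃ₗ[ℝ] V)} {S : Set (Set V)}

theorem mem_pointwiseStabilizer_iff {F : Set V} {γ : V ≃ₗ[ℝ] V} :
    γ ∈ pointwiseStabilizer Γ F ↔ γ ∈ Γ ∧ ∀ f ∈ F, γ f = f := by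
  rw [pointwiseStabilizer, Subgroup.mem_inf, mem_fixingSubgroup_iff]
  rfl

theorem mem_coneStar_of_mem_pointwiseStabilizer {F σ τ : Set V} (hσF : σ ⊆ F)
    (hinv : ∀ γ ∈ Γ, ∀ τ ∈ S, γ '' τ ∈ S) {γ : V ≃ₗ[ℝ] V} (hγ : γ ∈ pointwiseStabilizer Γ F)
    (hτ : τ ∈ coneStar S σ) : γ '' τ ∈ coneStar S σ := by
  rw [mem_pointwiseStabilizer_iff] at hγ
  exact ⟨hinv γ hγ.1 τ hτ.1, fun x hx => ⟨x, hτ.2 hx, hγ.2 x (hσF hx)⟩⟩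

theorem translates_image {G : Subgroup (V ≃ₗ[ℝ] V)} {γ : V ≃ₗ[ℝ] V} (hγ : γ ∈ G) (τ : Set V) :
    translates G (γ '' τ) = translates G τ := by
  ext τ'
  constructor
  · rintro ⟨δ, hδ, rfl⟩
    exact ⟨δ * γ, G.mul_mem hδ hγ, by rw [Set.image_image]; rfl⟩
  · rintro ⟨δ, hδ, rfl⟩
    refine ⟨δ * γ⁻¹, G.mul_mem hδ (G.inv_mem hγ), ?_⟩
    rw [Set.image_image]
    refine Set.image_congr fun x _ => ?_
    have e : γ⁻¹ (γ x) = x := γ.symm_apply_apply x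
    rw [LinearEquiv.mul_apply, e]

end Groups

/-! ### Members of the decomposition: faces, stars and stabilizers. -/

section Decomposition

variable {V : Type*} [NormedAddCommGroup V] [NormedSpace ℝ V] [Module ℚ V]
variable {VQ : Submodule ℚ V} {C : Set V} {K : PointedCone ℝ V} {L : Submodule ℤ V}
variable {Γ : Subgroup (V ≃ₗ[ℝ] V)} {G₀ : Finset V} {S : Set (Set V)}

theorem IsRationalPolyhedralCone.zero_mem {P : Set V} (hP : IsRationalPolyhedralCone VQ P) :
    (0 : V) ∈ P := by
  obtain ⟨S, -, -, rfl⟩ := hP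
  simp

theorem IsReductionDatum.hull_subset {X : Set V} (hd : IsReductionDatum VQ X K L Γ G₀) {G : Finset V}
    (hG : ∀ g ∈ G, g ∈ L ∧ g ∈ K) : (PointedCone.hull ℝ (G : Set V) : Set V) ⊆ X :=
  fun z hz => (hd.mem_iff z).2 ⟨G, hG, hz⟩

theorem IsReductionDatum.isRationalPolyhedralCone_hull {X : Set V}
    (hd : IsReductionDatum VQ X K L Γ G₀) {G : Finset V} (hG : ∀ g ∈ G, g ∈ L ∧ g ∈ K) :
    IsRationalPolyhedralCone VQ (PointedCone.hull ℝ (G : Set V) : Set V) :=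
  _root_.isRationalPolyhedralCone_hull hd.isRationalStructure G fun g hg => hd.rational g (hG g hg).1

theorem IsReductionDatum.subset_cone {X : Set V} (hd : IsReductionDatum VQ X K L Γ G₀) :
    X ⊆ K := by
  intro z hz
  obtain ⟨G, hG, hz⟩ := (hd.mem_iff z).1 hz
  exact Submodule.span_le.2 (fun g hg => (hG g hg).2) hz

section

/-- Local polyhedrality is applied to the cone `{0}`, generated by the empty set: a polyhedral cone
always contains the origin. -/
theorem IsReductionDatum.zero_mem
    (hd : IsReductionDatum VQ (rationalHull VQ C) K L Γ G₀)
    (hS : IsLocallyRationalDecomposition VQ C S)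
    {σ : Set V} (hσ : σ ∈ S) : (0 : V) ∈ σ :=
  ((hS.locally_polyhedral _ (hd.isRationalPolyhedralCone_hull (G := ∅) (by simp))
    (hd.hull_subset (by simp)) σ hσ).zero_mem).1

theorem IsReductionDatum.exists_inter_hull_eq
    (hd : IsReductionDatum VQ (rationalHull VQ C) K L Γ G₀)
    (hS : IsLocallyRationalDecomposition VQ C S)
    {σ : Set V} (hσ : σ ∈ S) {G : Finset V}
    (hG : ∀ g ∈ G, g ∈ L ∧ g ∈ K) :
    ∃ H : Finset V, (H : Set V) ⊆ VQ ∧ (H : Set V) ⊆ σ ∧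
      σ ∩ PointedCone.hull ℝ (G : Set V) = PointedCone.hull ℝ (H : Set V) := by
  obtain ⟨H, hHQ, hH⟩ := (hS.locally_polyhedral _ (hd.isRationalPolyhedralCone_hull hG)
    (hd.hull_subset hG) σ hσ).exists_hull_eq hd.isRationalStructure
  refine ⟨H, hHQ, fun h hh => ?_, hH⟩
  have : h ∈ σ ∩ PointedCone.hull ℝ (G : Set V) := hH ▸ PointedCone.subset_hull hh
  exact this.1

variable [FiniteDimensional ℝ V]

/-- A member of the decomposition whose relative interior meets another member is a face of it. -/
theorem IsReductionDatum.eq_faceAt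
    (hd : IsReductionDatum VQ (rationalHull VQ C) K L Γ G₀)
    (hS : IsLocallyRationalDecomposition VQ C S)
    {τ ρ : Set V} (hτ : τ ∈ S) (hρ : ρ ∈ S) {x : V}
    (hx : x ∈ intrinsicInterior ℝ τ) (hxρ : x ∈ ρ) : τ = faceAt ρ x := by
  have h0 := hd.zero_mem hS hρ
  have hρc := hS.isConvexCone ρ hρ
  -- This face has `x` in its relative interior, so disjointness of relative interiors identifies it
  -- with `τ`.
  have hF : faceAt ρ x ∈ S := hS.face_mem ρ hρ _ (hρc.isFace_faceAt h0 hxρ)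
  by_contra hne
  exact Set.disjoint_left.1 (hS.pairwiseDisjoint hτ hF hne) hx
    (hρc.mem_intrinsicInterior_faceAt h0 hxρ (hS.isConvexCone _ hF))

theorem IsReductionDatum.subset_of_mem_intrinsicInterior
    (hd : IsReductionDatum VQ (rationalHull VQ C) K L Γ G₀)
    (hS : IsLocallyRationalDecomposition VQ C S)
    {τ ρ : Set V} (hτ : τ ∈ S) (hρ : ρ ∈ S)
    {x : V} (hx : x ∈ intrinsicInterior ℝ τ) (hxρ : x ∈ ρ) : τ ⊆ ρ := by
  rw [hd.eq_faceAt hS hτ hρ hx hxρ]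
  exact fun z hz => hz.1

/-- Local finiteness bounds only the number of traces on a cone. A member whose relative interior
meets the cone is determined by its trace: two such members with the same trace contain each other.
-/
theorem IsReductionDatum.finite_meeting
    (hd : IsReductionDatum VQ (rationalHull VQ C) K L Γ G₀)
    (hS : IsLocallyRationalDecomposition VQ C S)
    {G : Finset V} (hG : ∀ g ∈ G, g ∈ L ∧ g ∈ K) :
    {τ | τ ∈ S ∧ ∃ x ∈ intrinsicInterior ℝ τ, x ∈ PointedCone.hull ℝ (G : Set V)}.Finite := by
  set P := (PointedCone.hull ℝ (G : Set V) : Set V) with hP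
  refine Set.Finite.of_finite_image (f := fun τ => τ ∩ P) ((hS.locally_finite P
    (hd.isRationalPolyhedralCone_hull hG) (hd.hull_subset hG)).subset ?_) ?_
  · rintro _ ⟨τ, hτ, rfl⟩
    exact ⟨τ, hτ.1, rfl⟩
  · have key : ∀ τ ρ : Set V, τ ∈ S → ρ ∈ S → (∃ x ∈ intrinsicInterior ℝ τ, x ∈ P) →
        τ ∩ P = ρ ∩ P → τ ⊆ ρ := by
      rintro τ ρ hτ hρ ⟨x, hx, hxP⟩ h
      have : x ∈ ρ ∩ P := h ▸ ⟨intrinsicInterior_subset hx, hxP⟩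
      exact hd.subset_of_mem_intrinsicInterior hS hτ hρ hx this.1
    rintro τ ⟨hτ, hτP⟩ ρ ⟨hρ, hρP⟩ h
    exact (key τ ρ hτ hρ hτP h).antisymm (key ρ τ hρ hτ hρP h.symm)

/-- Every member of the decomposition is spanned by linearly independent lattice points. -/
theorem IsReductionDatum.exists_spanning_lattice_points
    (hd : IsReductionDatum VQ (rationalHull VQ C) K L Γ G₀)
    (hS : IsLocallyRationalDecomposition VQ C S)
    {σ : Set V} (hσ : σ ∈ S) :
    ∃ F : Finset V, (∀ f ∈ F, f ∈ L ∧ f ∈ σ) ∧ σ ⊆ Submodule.span ℝ (F : Set V) ∧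
      LinearIndependent ℝ (fun f : F => (f : V)) := by
  obtain ⟨b, hb, hspan, hli⟩ := exists_linearIndependent ℝ ((L : Set V) ∩ σ)
  have hbf : b.Finite := hli.setFinite
  refine ⟨hbf.toFinset, fun f hf => hb (hbf.mem_toFinset.1 hf), fun x hx => ?_, ?_⟩
  · rw [hbf.coe_toFinset, hspan]
    obtain ⟨G, hG, hxG⟩ := (hd.mem_iff x).1 (hS.subset σ hσ hx)
    obtain ⟨H, hHQ, hHσ, hH⟩ := hd.exists_inter_hull_eq hS hσ hG
    have hxH : x ∈ PointedCone.hull ℝ (H : Set V) := by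
      rw [← SetLike.mem_coe, ← hH]; exact ⟨hx, hxG⟩
    have hle : Submodule.span ℝ (H : Set V) ≤ Submodule.span ℝ ((L : Set V) ∩ σ) := by
      refine Submodule.span_le.2 fun h hh => ?_
      obtain ⟨m, hm, hmL⟩ := hd.exists_nsmul_mem h (hHQ hh)
      have hm0 : (0 : ℝ) < m := by exact_mod_cast hm
      have hmσ : m • h ∈ σ := by
        rw [← Nat.cast_smul_eq_nsmul ℝ]
        exact (hS.isConvexCone σ hσ).smul_mem _ hm0 h (hHσ hh)
      have h1 : m • h ∈ Submodule.span ℝ ((L : Set V) ∩ σ) := Submodule.subset_span ⟨hmL, hmσ⟩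
      have h2 := Submodule.smul_mem _ (m : ℝ)⁻¹ h1
      have e : (m : ℝ)⁻¹ • m • h = h := by
        rw [← Nat.cast_smul_eq_nsmul ℝ, inv_smul_smul₀ hm0.ne']
      rwa [e] at h2
    exact hle (PointedCone.hull_le_span ℝ _ hxH)
  · exact hli.comp (fun f : hbf.toFinset => (⟨f, hbf.mem_toFinset.1 f.2⟩ : b)) fun f g h =>
      Subtype.ext (congrArg (fun v : b => (v : V)) h)

theorem IsReductionDatum.exists_lattice_point
    (hd : IsReductionDatum VQ (rationalHull VQ C) K L Γ G₀)
    (hS : IsLocallyRationalDecomposition VQ C S)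
    {σ : Set V} (hσ : σ ∈ S) :
    ∃ x ∈ L, x ∈ intrinsicInterior ℝ σ := by
  obtain ⟨F, hF, hspan, -⟩ := hd.exists_spanning_lattice_points hS hσ
  exact ⟨∑ f ∈ F, f, L.sum_mem fun f hf => (hF f hf).1,
    (hS.isConvexCone σ hσ).sum_mem_intrinsicInterior (hd.zero_mem hS hσ)
      (fun f hf => (hF f hf).2) hspan⟩

end

/-- The face of `X` generated by a lattice point is spanned by lattice points. -/
theorem IsReductionDatum.faceAt_subset_span {X : Set V} (hd : IsReductionDatum VQ X K L Γ G₀)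
    (x : V) : faceAt X x ⊆ Submodule.span ℝ ((L : Set V) ∩ faceAt X x) := by
  classical
  rintro f ⟨hf, m, hm, hmf⟩
  obtain ⟨G, hG, hfG⟩ := (hd.mem_iff f).1 hf
  obtain ⟨c, hc, rfl⟩ := mem_hull_finset.1 hfG
  have hGX : ∀ g ∈ G, g ∈ X := fun g hg => hd.hull_subset hG (PointedCone.subset_hull hg)
  have h0 : (0 : V) ∈ X := hd.hull_subset (G := ∅) (by simp) (Submodule.zero_mem _)
  refine Submodule.sum_mem _ fun g hg => ?_
  rcases (hc g).eq_or_lt with h | h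
  · rw [← h, zero_smul]; exact Submodule.zero_mem _
  -- A generator that occurs with positive coefficient in an element below `m • x` is itself below a
  -- multiple of `x`.
  · refine Submodule.smul_mem _ _ (Submodule.subset_span ⟨(hG g hg).1, hGX g hg,
      (c g)⁻¹ * m, by positivity, ?_⟩)
    have e : ((c g)⁻¹ * m) • x - g =
        (c g)⁻¹ • ((m • x - ∑ k ∈ G, c k • k) + ∑ k ∈ G.erase g, c k • k) := by
      rw [← Finset.add_sum_erase _ _ hg, sub_add_eq_sub_sub, sub_add_cancel, smul_sub, smul_smul,
        inv_smul_smul₀ h.ne']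
    rw [e]
    refine hd.isConvexCone.smul_mem _ (inv_pos.2 h) _ (hd.isConvexCone.add_mem hmf ?_)
    exact (hd.isConvexCone.toPointedCone h0).sum_mem fun k hk =>
      hd.isConvexCone.smul_mem_of_nonneg h0 (hc k) (hGX k (Finset.mem_of_mem_erase hk))

variable [FiniteDimensional ℝ V]

/-- The elements of `Γ` that move a lattice point `x` into a cone generated by lattice points form
finitely many cosets of the pointwise stabilizer of the face generated by `x`. -/
theorem IsReductionDatum.finite_cosets {X : Set V} (hd : IsReductionDatum VQ X K L Γ G₀)
    {x : V} (hxL : x ∈ L) (hxX : x ∈ X) {G : Finset V} (hG : ∀ g ∈ G, g ∈ L ∧ g ∈ K) :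
    ∃ R : Set (V ≃ₗ[ℝ] V), R.Finite ∧ R ⊆ Γ ∧ ∀ γ ∈ Γ, γ x ∈ PointedCone.hull ℝ (G : Set V) →
      ∃ ρ ∈ R, ρ⁻¹ * γ ∈ pointwiseStabilizer Γ (faceAt X x) := by
  obtain ⟨b, hb, hspan, hli⟩ := exists_linearIndependent ℝ ((L : Set V) ∩ faceAt X x)
  have hbf : b.Finite := hli.setFinite
  have : Finite b := hbf
  set Θ : Set (V ≃ₗ[ℝ] V) := {γ | γ ∈ Γ ∧ γ x ∈ PointedCone.hull ℝ (G : Set V)} with hΘ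
  set φ : (V ≃ₗ[ℝ] V) → b → V := fun γ v => γ v with hφ
  have hxK : x ∈ K := hd.subset_cone hxX
  have horbit := hd.isConeLattice.finite_orbit_inter_hull hd.map_cone hd.map_lattice hG hxL hxK
  have hfin : (φ '' Θ).Finite := by
    -- There are finitely many values of `γ x`. A basis vector `v` from the face is below some `m •
    -- x`, so `γ v` lies in the finite lattice interval below `m • γ x`. Hence the restrictions of
    -- `γ` to the span of the face form a finite set.
    have hpi : (Set.pi Set.univ fun v : b => {w : V | ∃ γ ∈ Θ, γ v = w}).Finite := by
      refine Set.Finite.pi fun v => ?_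
      obtain ⟨hvL, hvX, m, hm, hmv⟩ := hb v.2
      refine (horbit.biUnion fun y _ =>
        hd.isConeLattice.finite_latticeInterval (m • y)).subset ?_
      rintro _ ⟨γ, hγ, rfl⟩
      refine Set.mem_biUnion (x := γ x) ⟨⟨γ, hγ.1, rfl⟩, hγ.2⟩
        ⟨hd.map_lattice γ hγ.1 v hvL, hd.map_cone γ hγ.1 v (hd.subset_cone hvX), ?_⟩
      have := hd.map_cone γ hγ.1 _ (hd.subset_cone hmv)
      rwa [map_sub, map_smul] at this
    refine hpi.subset ?_
    rintro _ ⟨γ, hγ, rfl⟩ v -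
    exact ⟨γ, hγ, rfl⟩
  refine ⟨Function.invFunOn φ Θ '' (φ '' Θ), hfin.image _, ?_, fun γ hγ hγx => ?_⟩
  · rintro _ ⟨_, ⟨γ, hγ, rfl⟩, rfl⟩
    exact (Function.invFunOn_mem (f := φ) ⟨γ, hγ, rfl⟩).1
  · have hex : ∃ a ∈ Θ, φ a = φ γ := ⟨γ, ⟨hγ, hγx⟩, rfl⟩
    set ρ := Function.invFunOn φ Θ (φ γ) with hρ
    have hρΓ : ρ ∈ Γ := (Function.invFunOn_mem hex).1
    have hργ : φ ρ = φ γ := Function.invFunOn_eq hex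
    refine ⟨ρ, ⟨_, ⟨γ, ⟨hγ, hγx⟩, rfl⟩, rfl⟩, mem_pointwiseStabilizer_iff.2
      ⟨Γ.mul_mem (Γ.inv_mem hρΓ) hγ, fun f hf => ?_⟩⟩
    have hEq : Set.EqOn (γ.toLinearMap) (ρ.toLinearMap) (Submodule.span ℝ b) :=
      LinearMap.eqOn_span fun v hv => (congrFun hργ ⟨v, hv⟩).symm
    have hfb : f ∈ Submodule.span ℝ b := by
      rw [hspan]; exact hd.faceAt_subset_span x hf
    have h1 : γ f = ρ f := hEq hfb
    rw [LinearEquiv.mul_apply, h1]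
    exact ρ.symm_apply_apply f

/-- The star of a member of the decomposition is finite modulo the pointwise stabilizer of the
smallest face of `C₊` that contains it. -/
theorem IsReductionDatum.finite_star (hd : IsReductionDatum VQ (rationalHull VQ C) K L Γ G₀)
    (hS : IsLocallyRationalDecomposition VQ C S) (hinv : ∀ γ ∈ Γ, ∀ τ ∈ S, γ '' τ ∈ S)
    {σ : Set V} (hσ : σ ∈ S) :
    ∃ T : Set (Set V), T.Finite ∧ ∀ τ ∈ coneStar S σ,
      ∃ z ∈ pointwiseStabilizer Γ (smallestFace (rationalHull VQ C) σ), z '' τ ∈ T := by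
  obtain ⟨x, hxL, hxσ⟩ := hd.exists_lattice_point hS hσ
  have hσc := hS.isConvexCone σ hσ
  have hσ0 := hd.zero_mem hS hσ
  have hσX := hS.subset σ hσ
  have hxσ' := intrinsicInterior_subset hxσ
  have hX0 := hσX hσ0
  obtain ⟨G, hG, hseg⟩ := hd.isConeLattice.exists_hull_segment hd.interior_nonempty hd.map_cone
    hd.map_lattice hd.generators_mem fun G hG z hz => hd.cover z (hd.hull_subset hG hz)
  obtain ⟨R, hR, hRΓ, hcoset⟩ := hd.finite_cosets hxL (hσX hxσ') hG
  -- The cosets are those of the stabilizer of `faceAt`; this inclusion makes their elements fix the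
  -- smallest face.
  have hface : smallestFace (rationalHull VQ C) σ ⊆ faceAt (rationalHull VQ C) x :=
    (isLeast_smallestFace hd.isConvexCone.convex hσc.nonempty hσX).2
      ⟨hd.isConvexCone.isFace_faceAt hX0 (hσX hxσ'), hσc.subset_faceAt hσ0 hσX hxσ⟩
  have hT := hd.finite_meeting hS hG
  refine ⟨Set.image2 (fun ρ τ => (ρ⁻¹ : V ≃ₗ[ℝ] V) '' τ) R _, hR.image2 _ hT, fun τ hτ => ?_⟩
  obtain ⟨y, hyL, hyτ⟩ := hd.exists_lattice_point hS hτ.1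
  have hτc := hS.isConvexCone τ hτ.1
  have hτ0 := hd.zero_mem hS hτ.1
  have hτX := hS.subset τ hτ.1
  obtain ⟨γ, hγ, t, ht, hγx, hγy⟩ := hseg x ⟨hxL, hd.subset_cone (hσX hxσ')⟩ y
    ⟨hyL, hd.subset_cone (hτX (intrinsicInterior_subset hyτ))⟩
  obtain ⟨ρ, hρ, hz⟩ := hcoset γ hγ hγx
  have hz' := mem_pointwiseStabilizer_iff.1 hz
  refine ⟨ρ⁻¹ * γ, mem_pointwiseStabilizer_iff.2 ⟨hz'.1, fun f hf => hz'.2 f (hface hf)⟩,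
    ρ, hρ, γ '' τ, ⟨hinv γ hγ τ hτ.1, γ (x + t • y), ?_, hγy⟩, ?_⟩
  · rw [← hτc.image_intrinsicInterior hτ0]
    exact ⟨_, hτc.add_smul_mem_intrinsicInterior hτ0 (hτ.2 hxσ') hyτ ht, rfl⟩
  · change (ρ⁻¹ : V ≃ₗ[ℝ] V) '' (γ '' τ) = _
    rw [Set.image_image]
    rfl

/-- The stabilizer of a member `σ` of the decomposition has a finitely generated rational cone in
`σ` whose translates cover `σ`. -/
theorem IsReductionDatum.exists_cover (hd : IsReductionDatum VQ (rationalHull VQ C) K L Γ G₀)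
    (hS : IsLocallyRationalDecomposition VQ C S) (hinv : ∀ γ ∈ Γ, ∀ τ ∈ S, γ '' τ ∈ S)
    {σ : Set V} (hσ : σ ∈ S) :
    ∃ H : Finset V, (H : Set V) ⊆ σ ∧
      ∀ x ∈ σ, ∃ δ ∈ Γ, δ '' σ = σ ∧ δ x ∈ PointedCone.hull ℝ (H : Set V) := by
  classical
  have hT := hd.finite_meeting hS hd.generators_mem
  set T := {τ | τ ∈ S ∧ ∃ x ∈ intrinsicInterior ℝ τ, x ∈ PointedCone.hull ℝ (G₀ : Set V)} with hTdef
  have hstar : ∀ τ ∈ T, ∃ R : Set (Set V), R.Finite ∧ ∀ ρ ∈ coneStar S τ,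
      ∃ z ∈ pointwiseStabilizer Γ (smallestFace (rationalHull VQ C) τ), z '' ρ ∈ R :=
    fun τ hτ => hd.finite_star hS hinv hτ.1
  choose! R hR hRstar using hstar
  -- The finitely many shapes that `σ` can take after a point of it has been moved into `hull G₀`;
  -- each is a translate of `σ`.
  set Q : Set (Set V) := {ρ | ρ ∈ ⋃ τ ∈ T, R τ ∧ ∃ g ∈ Γ, g '' ρ = σ} with hQdef
  have hQ : Q.Finite := (hT.biUnion hR).subset fun ρ hρ => hρ.1
  have hQS : ∀ ρ ∈ Q, ∃ g ∈ Γ, g '' ρ = σ ∧ ∃ H : Finset V, (H : Set V) ⊆ σ ∧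
      ∀ v ∈ ρ, v ∈ PointedCone.hull ℝ (G₀ : Set V) → g v ∈ PointedCone.hull ℝ (H : Set V) := by
    rintro ρ ⟨-, g, hg, rfl⟩
    have hρS : ρ ∈ S := by
      have := hinv _ (Γ.inv_mem hg) _ hσ
      have e : (g⁻¹ : V ≃ₗ[ℝ] V) '' (g '' ρ) = ρ := g.toEquiv.symm_image_image ρ
      rwa [e] at this
    obtain ⟨H, -, hHρ, hH⟩ := hd.exists_inter_hull_eq hS hρS hd.generators_mem
    refine ⟨g, hg, rfl, H.image g, ?_, fun v hv hvG => ?_⟩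
    · rw [Finset.coe_image]
      exact Set.image_mono hHρ
    · have hvH : v ∈ PointedCone.hull ℝ (H : Set V) := by
        rw [← SetLike.mem_coe, ← hH]; exact ⟨hv, hvG⟩
      refine map_mem_hull_of_forall_mem g (fun h hh => PointedCone.subset_hull ?_) hvH
      exact_mod_cast Finset.mem_image_of_mem g hh
  choose! g hg hgσ H hHσ hH using hQS
  refine ⟨hQ.toFinset.biUnion H, fun h hh => ?_, fun x hx => ?_⟩
  · obtain ⟨ρ, hρ, hh⟩ := Finset.mem_biUnion.1 (Finset.mem_coe.1 hh)
    exact hHσ ρ (hQ.mem_toFinset.1 hρ) hh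
  · have hxX := hS.subset σ hσ hx
    obtain ⟨τ, hτ, hxτ⟩ : ∃ τ ∈ S, x ∈ intrinsicInterior ℝ τ := by
      simpa using hS.iUnion_eq.symm.le hxX
    have hτσ := hd.subset_of_mem_intrinsicInterior hS hτ hσ hxτ hx
    obtain ⟨γ, hγ, hγx⟩ := hd.cover x hxX
    have hγxτ : γ x ∈ intrinsicInterior ℝ (γ '' τ) := by
      rw [← (hS.isConvexCone τ hτ).image_intrinsicInterior (hd.zero_mem hS hτ)]
      exact ⟨x, hxτ, rfl⟩
    have hτT : γ '' τ ∈ T := ⟨hinv γ hγ τ hτ, γ x, hγxτ, hγx⟩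
    obtain ⟨z, hz, hzR⟩ := hRstar _ hτT (γ '' σ) ⟨hinv γ hγ σ hσ, Set.image_mono hτσ⟩
    rw [mem_pointwiseStabilizer_iff] at hz
    -- The smallest face containing `γ '' τ` contains `γ x`, so correcting by `z` does not move the
    -- point out of `hull G₀`.
    have hzx : z (γ x) = γ x :=
      hz.2 _ (Set.mem_sInter.2 fun F hF => hF.2 ⟨x, intrinsicInterior_subset hxτ, rfl⟩)
    set ρ := z '' (γ '' σ) with hρ
    have hρQ : ρ ∈ Q := by
      refine ⟨Set.mem_biUnion hτT hzR, (z * γ)⁻¹, Γ.inv_mem (Γ.mul_mem hz.1 hγ), ?_⟩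
      have e : ρ = (z * γ : V ≃ₗ[ℝ] V) '' σ := by
        rw [hρ, Set.image_image]
        rfl
      rw [e]
      exact (z * γ).toEquiv.symm_image_image σ
    refine ⟨g ρ * (z * γ), Γ.mul_mem (hg ρ hρQ) (Γ.mul_mem hz.1 hγ), ?_, ?_⟩
    · conv_rhs => rw [← hgσ ρ hρQ, hρ, Set.image_image, Set.image_image]
      rfl
    · have hgx : g ρ (γ x) ∈ PointedCone.hull ℝ (H ρ : Set V) :=
        hH ρ hρQ _ ⟨γ x, ⟨x, hx, rfl⟩, hzx⟩ hγx
      rw [LinearEquiv.mul_apply, LinearEquiv.mul_apply, hzx]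
      exact Submodule.span_mono (Finset.coe_subset.2
        (Finset.subset_biUnion_of_mem H (hQ.mem_toFinset.2 hρQ))) hgx

end Decomposition

/-! ### The induced triple on the linear span of a member. -/

section InducedPair

theorem image_eq_of_forall_mem {W : Type*} [AddCommGroup W] [Module ℝ W]
    {G : Subgroup (W ≃ₗ[ℝ] W)} {A : Set W} (h : ∀ δ ∈ G, ∀ w ∈ A, δ w ∈ A) :
    ∀ δ ∈ G, δ '' A = A := by
  intro δ hδ
  refine Set.Subset.antisymm (Set.image_subset_iff.2 (h δ hδ)) fun w hw => ?_
  exact ⟨δ⁻¹ w, h _ (G.inv_mem hδ) w hw, δ.apply_symm_apply w⟩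

variable {V : Type*} [NormedAddCommGroup V] [NormedSpace ℝ V]

/-- A closed salient cone contains no line. -/
theorem PointedCone.isNondegenerate {K : PointedCone ℝ V} (hK : IsClosed (K : Set V))
    (hs : ∀ x ∈ K, -x ∈ K → x = 0) : IsNondegenerate (K : Set V) := by
  intro x v hv
  by_contra! hcon
  have key : ∀ u : V, (∀ n : ℕ, x + ((n : ℝ) + 1) • u ∈ K) → u ∈ K := by
    intro u hu
    have ht : Filter.Tendsto (fun n : ℕ => (1 / ((n : ℝ) + 1)) • x + u) Filter.atTop (nhds u) := by
      simpa using ((tendsto_one_div_add_atTop_nhds_zero_nat (𝕜 := ℝ)).smul_const x).add_const u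
    refine hK.mem_of_tendsto ht (Filter.Eventually.of_forall fun n => ?_)
    have hn : (0 : ℝ) < (n : ℝ) + 1 := by positivity
    have h := K.smul_mem (r := 1 / ((n : ℝ) + 1)) (by positivity) (hu n)
    rwa [smul_add, smul_smul, one_div_mul_cancel hn.ne', one_smul] at h
  refine hv (hs v (key v fun n => hcon _) (key (-v) fun n => ?_))
  have := hcon (-((n : ℝ) + 1))
  rwa [neg_smul, ← smul_neg] at this

theorem exists_mem_inducedGroup {Γ : Subgroup (V ≃ₗ[ℝ] V)} {σ : Set V} {γ : V ≃ₗ[ℝ] V}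
    (hγ : γ ∈ Γ) (hσ : γ '' σ = σ) :
    ∃ δ ∈ inducedGroup Γ σ, ∀ x : Submodule.span ℝ σ, (δ x : V) = γ x := by
  have h : (Submodule.span ℝ σ).map (γ : V →ₗ[ℝ] V) = Submodule.span ℝ σ := by
    rw [Submodule.map_span]
    exact congrArg _ hσ
  exact ⟨γ.ofSubmodules _ _ h, ⟨γ, hγ, hσ, fun x => rfl⟩, fun x => rfl⟩

variable [FiniteDimensional ℝ V] [Module ℚ V]
variable {VQ : Submodule ℚ V} {C : Set V} {K : PointedCone ℝ V} {L : Submodule ℤ V}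
variable {Γ : Subgroup (V ≃ₗ[ℝ] V)} {G₀ : Finset V} {S : Set (Set V)} {σ : Set V}

theorem IsReductionDatum.isRationalStructure_rationalSpan
    (hd : IsReductionDatum VQ (rationalHull VQ C) K L Γ G₀)
    (hS : IsLocallyRationalDecomposition VQ C S) (hσ : σ ∈ S) :
    IsRationalStructure (rationalSpan VQ σ) := by
  obtain ⟨F, hF, hspan, hli⟩ := hd.exists_spanning_lattice_points hS hσ
  set w : F → Submodule.span ℝ σ := fun f => ⟨f, Submodule.subset_span (hF f f.2).2⟩ with hw
  have hwli : LinearIndependent ℝ w :=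
    LinearIndependent.of_comp (Submodule.span ℝ σ).subtype hli
  have hrange : Subtype.val '' Set.range w = (F : Set V) := by
    rw [← Set.range_comp]
    exact Subtype.range_coe
  have hwspan : ⊤ ≤ Submodule.span ℝ (Set.range w) := by
    rintro x -
    have hx : (x : V) ∈ Submodule.span ℝ (F : Set V) := Submodule.span_le.2 hspan x.2
    rw [← hrange] at hx
    have : (Submodule.span ℝ σ).subtype '' Set.range w = Subtype.val '' Set.range w := rfl
    rw [← this, Submodule.span_image] at hx
    obtain ⟨y, hy, hyx⟩ := hx
    rwa [← Subtype.ext hyx]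
  let b₀ := Basis.mk hwli hwspan
  have hcard : Nat.card F = finrank ℝ (Submodule.span ℝ σ) := (finrank_eq_nat_card_basis b₀).symm
  refine ⟨b₀.reindex (Finite.equivFinOfCardEq hcard), le_antisymm (fun x hx => ?_) ?_⟩
  · rw [Basis.range_reindex, Basis.coe_mk]
    have hx' : (x : V) ∈ Submodule.span ℚ (F : Set V) :=
      hd.isRationalStructure.mem_span_rat (fun f hf => hd.rational f (hF f hf).1) hx
        (Submodule.span_le.2 hspan x.2)
    rw [← hrange] at hx'
    have : (Submodule.span ℝ σ).subtype.restrictScalars ℚ '' Set.range w =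
        Subtype.val '' Set.range w := rfl
    rw [← this, Submodule.span_image] at hx'
    obtain ⟨y, hy, hyx⟩ := hx'
    rwa [← Subtype.ext hyx]
  · rw [Basis.range_reindex, Basis.coe_mk, Submodule.span_le]
    rintro _ ⟨f, rfl⟩
    exact hd.rational f (hF f f.2).1

theorem IsReductionDatum.isConvexCone_preimage_intrinsicInterior
    (hd : IsReductionDatum VQ (rationalHull VQ C) K L Γ G₀)
    (hS : IsLocallyRationalDecomposition VQ C S) (hσ : σ ∈ S) :
    IsConvexCone (Subtype.val ⁻¹' intrinsicInterior ℝ σ : Set (Submodule.span ℝ σ)) where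
  nonempty := by
    obtain ⟨x, -, hx⟩ := hd.exists_lattice_point hS hσ
    exact ⟨⟨x, Submodule.subset_span (intrinsicInterior_subset hx)⟩, hx⟩
  convex := by
    rw [IsConvexCone.preimage_intrinsicInterior (hd.zero_mem hS hσ)]
    exact ((hS.isConvexCone σ hσ).convex.linear_preimage (Submodule.span ℝ σ).subtype).interior
  smul_mem c hc x hx :=
    (hS.isConvexCone σ hσ).smul_mem_intrinsicInterior (hd.zero_mem hS hσ) hx hc

/-- A member `σ` of the decomposition is the convex hull of the rational points in its closure. -/
theorem IsReductionDatum.rationalHull_preimage_intrinsicInterior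
    (hd : IsReductionDatum VQ (rationalHull VQ C) K L Γ G₀)
    (hS : IsLocallyRationalDecomposition VQ C S) (hσ : σ ∈ S) :
    rationalHull (rationalSpan VQ σ)
      (Subtype.val ⁻¹' intrinsicInterior ℝ σ : Set (Submodule.span ℝ σ)) =
        Subtype.val ⁻¹' σ := by
  classical
  have h0 := hd.zero_mem hS hσ
  have hσc := hS.isConvexCone σ hσ
  have hconv : Convex ℝ (Subtype.val ⁻¹' σ : Set (Submodule.span ℝ σ)) :=
    hσc.convex.linear_preimage (Submodule.span ℝ σ).subtype
  obtain ⟨y, hyL, hy⟩ := hd.exists_lattice_point hS hσ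
  have hDc := hd.isConvexCone_preimage_intrinsicInterior hS hσ
  set D : Set (Submodule.span ℝ σ) := Subtype.val ⁻¹' intrinsicInterior ℝ σ with hD
  set y' : Submodule.span ℝ σ := ⟨y, Submodule.subset_span (intrinsicInterior_subset hy)⟩
  apply Set.Subset.antisymm
  · refine convexHull_min ?_ hconv
    rintro x ⟨hx, hxQ⟩
    have hσK : σ ⊆ K := (hS.subset σ hσ).trans hd.subset_cone
    have hxK : (x : V) ∈ K := by
      have h1 : (x : V) ∈ closure (intrinsicInterior ℝ σ) :=
        map_mem_closure continuous_subtype_val hx fun z hz => hz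
      exact hd.isConeLattice.isClosed.closure_subset_iff.2
        (intrinsicInterior_subset.trans hσK) h1
    obtain ⟨m, hm, hmx⟩ := hd.exists_nsmul_mem x hxQ
    have hm0 : (0 : ℝ) < m := by exact_mod_cast hm
    -- `σ` itself need not be closed, but its trace on the rational cone generated by `y` and `x`
    -- is. The points of the open segment from the relatively interior point `y` to `x` belong to
    -- this trace, so `x` does too.
    set G : Finset V := {y, m • (x : V)} with hGdef
    have hG : ∀ g ∈ G, g ∈ L ∧ g ∈ K := by
      intro g hg
      rw [hGdef, Finset.mem_insert, Finset.mem_singleton] at hg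
      rcases hg with rfl | rfl
      · exact ⟨hyL, hσK (intrinsicInterior_subset hy)⟩
      · refine ⟨hmx, ?_⟩
        rw [← Nat.cast_smul_eq_nsmul ℝ]
        exact K.smul_mem hm0.le hxK
    obtain ⟨H, -, -, hH⟩ := hd.exists_inter_hull_eq hS hσ hG
    have hcl : IsClosed (σ ∩ PointedCone.hull ℝ (G : Set V)) :=
      hH ▸ (isPolyhedralCone_hull H).isClosed
    have hyG : y ∈ PointedCone.hull ℝ (G : Set V) := PointedCone.subset_hull (by simp [hGdef])
    have hxG : (x : V) ∈ PointedCone.hull ℝ (G : Set V) := by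
      have h1 : m • (x : V) ∈ PointedCone.hull ℝ (G : Set V) :=
        PointedCone.subset_hull (by simp [hGdef])
      have h2 := PointedCone.smul_mem _ (inv_nonneg.2 hm0.le) h1
      have e : (m : ℝ)⁻¹ • m • (x : V) = x := by
        rw [← Nat.cast_smul_eq_nsmul ℝ, inv_smul_smul₀ hm0.ne']
      rwa [e] at h2
    have hseg : ∀ t ∈ Set.Ioo (0 : ℝ) 1, t • y + (1 - t) • (x : V) ∈
        σ ∩ PointedCone.hull ℝ (G : Set V) := by
      rintro t ⟨ht0, ht1⟩
      refine ⟨?_, Submodule.add_mem _ (PointedCone.smul_mem _ ht0.le hyG)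
        (PointedCone.smul_mem _ (sub_nonneg.2 ht1.le) hxG)⟩
      have hy' : y' ∈ interior (Subtype.val ⁻¹' σ : Set (Submodule.span ℝ σ)) := by
        rw [← IsConvexCone.preimage_intrinsicInterior h0]; exact hy
      have hx' : x ∈ closure (Subtype.val ⁻¹' σ : Set (Submodule.span ℝ σ)) :=
        closure_mono (s := D) (fun z hz => intrinsicInterior_subset (s := σ) hz) hx
      have := interior_subset (hconv.openSegment_interior_closure_subset_interior hy' hx'
        ⟨t, 1 - t, ht0, sub_pos.2 ht1, by ring, rfl⟩)
      exact this
    have hc : Continuous fun t : ℝ => t • y + (1 - t) • (x : V) := by fun_prop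
    have ht : Filter.Tendsto (fun t : ℝ => t • y + (1 - t) • (x : V))
        (nhdsWithin 0 (Set.Ioi 0)) (nhds (x : V)) := by
      simpa using (hc.tendsto 0).mono_left nhdsWithin_le_nhds
    exact (hcl.mem_of_tendsto ht (Filter.mem_of_superset (Ioo_mem_nhdsGT one_pos) hseg)).1
  · intro z hz
    have hz' : (z : V) ∈ σ := hz
    obtain ⟨G, hG, hzG⟩ := (hd.mem_iff z).1 (hS.subset σ hσ hz')
    obtain ⟨H, hHQ, hHσ, hH⟩ := hd.exists_inter_hull_eq hS hσ hG
    have hzH : (z : V) ∈ PointedCone.hull ℝ (H : Set V) := by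
      rw [← SetLike.mem_coe, ← hH]; exact ⟨hz', hzG⟩
    have hclD : ∀ w : Submodule.span ℝ σ, (w : V) ∈ σ → w ∈ closure D := by
      intro w hw
      have hc : Continuous fun t : ℝ => w + t • y' := by fun_prop
      have ht : Filter.Tendsto (fun t : ℝ => w + t • y') (nhdsWithin 0 (Set.Ioi 0)) (nhds w) := by
        simpa using (hc.tendsto 0).mono_left nhdsWithin_le_nhds
      refine mem_closure_of_tendsto ht ?_
      filter_upwards [self_mem_nhdsWithin] with t ht
      exact hσc.add_smul_mem_intrinsicInterior h0 hw hy ht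
    -- Conversely, `z` lies in a rational polyhedral trace of `σ`. Its generators are rational
    -- points of `σ`, hence of the closure of the relative interior.
    have hle : PointedCone.hull ℝ (H : Set V) ≤ PointedCone.map (Submodule.span ℝ σ).subtype
        ((hDc.rationalHull (VQ := rationalSpan VQ σ)).toPointedCone hDc.zero_mem_rationalHull) := by
      refine Submodule.span_le.2 fun h hh => ?_
      exact ⟨⟨h, Submodule.subset_span (hHσ hh)⟩,
        subset_rationalHull ⟨hclD _ (hHσ hh), hHQ hh⟩, rfl⟩
    obtain ⟨w, hw, hwz⟩ := hle hzH
    have : w = z := Subtype.ext hwz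
    exact this ▸ hw

theorem IsReductionDatum.exists_induced_lattice
    (hd : IsReductionDatum VQ (rationalHull VQ C) K L Γ G₀)
    (hS : IsLocallyRationalDecomposition VQ C S) (hσ : σ ∈ S) :
    ∃ L' : Submodule ℤ (Submodule.span ℝ σ), IsRationalLattice (rationalSpan VQ σ) L' ∧
      ∀ δ ∈ inducedGroup Γ σ, δ '' (L' : Set (Submodule.span ℝ σ)) = L' := by
  refine ⟨L.comap ((Submodule.span ℝ σ).subtype.restrictScalars ℤ), ⟨fun x hx =>
    hd.rational x hx, ?_, ?_⟩, image_eq_of_forall_mem ?_⟩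
  · have := hd.isConeLattice.discrete
    let f : L.comap ((Submodule.span ℝ σ).subtype.restrictScalars ℤ) → L := fun x => ⟨x.1, x.2⟩
    have hf : Continuous f := by fun_prop
    exact DiscreteTopology.of_continuous_injective hf fun x y h =>
      Subtype.ext (Subtype.ext (congrArg (fun v : L => (v : V)) h))
  · obtain ⟨F, hF, hspan, -⟩ := hd.exists_spanning_lattice_points hS hσ
    refine eq_top_iff.2 fun x _ => ?_
    have hx : (x : V) ∈ Submodule.span ℝ (F : Set V) := Submodule.span_le.2 hspan x.2
    have hle : Submodule.span ℝ (F : Set V) ≤ (Submodule.span ℝ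
        ((L.comap ((Submodule.span ℝ σ).subtype.restrictScalars ℤ) :
          Submodule ℤ (Submodule.span ℝ σ)) : Set (Submodule.span ℝ σ))).map
        (Submodule.span ℝ σ).subtype := by
      refine Submodule.span_le.2 fun f hf => ?_
      exact ⟨⟨f, Submodule.subset_span (hF f hf).2⟩, Submodule.subset_span (hF f hf).1, rfl⟩
    obtain ⟨w, hw, hwx⟩ := hle hx
    have : w = x := Subtype.ext hwx
    exact this ▸ hw
  · rintro δ ⟨γ, hγ, -, hδ⟩ w hw
    change ((δ w : Submodule.span ℝ σ) : V) ∈ L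
    rw [hδ]
    exact hd.map_lattice γ hγ _ hw

theorem IsReductionDatum.exists_induced_cone
    (hd : IsReductionDatum VQ (rationalHull VQ C) K L Γ G₀)
    (hS : IsLocallyRationalDecomposition VQ C S) (hinv : ∀ γ ∈ Γ, ∀ τ ∈ S, γ '' τ ∈ S)
    (hσ : σ ∈ S) :
    ∃ P : Set (Submodule.span ℝ σ), IsPolyhedralCone P ∧ P ⊆ Subtype.val ⁻¹' σ ∧
      ⋃ δ ∈ inducedGroup Γ σ, δ '' P = Subtype.val ⁻¹' σ := by
  obtain ⟨H, hHσ, hH⟩ := hd.exists_cover hS hinv hσ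
  have hsub : (PointedCone.hull ℝ (H : Set V) : Set V) ⊆ σ :=
    (hS.isConvexCone σ hσ).hull_subset (hd.zero_mem hS hσ) hHσ
  refine ⟨Subtype.val ⁻¹' (PointedCone.hull ℝ (H : Set V) : Set V), ?_,
    Set.preimage_mono hsub, Set.Subset.antisymm (Set.iUnion₂_subset ?_) fun w hw => ?_⟩
  · obtain ⟨A, hA, h⟩ := isPolyhedralCone_hull H
    refine ⟨(fun f => f ∘ₗ (Submodule.span ℝ σ).subtype) '' A, hA.image _, ?_⟩
    rw [h]
    ext x
    simp
  · rintro δ ⟨γ, -, hγσ, hδ⟩ _ ⟨w, hw, rfl⟩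
    have h : γ (w : V) ∈ γ '' σ := ⟨w, hsub hw, rfl⟩
    rw [Set.mem_preimage, hδ]
    exact hγσ.subset h
  · obtain ⟨γ, hγ, hγσ, hγw⟩ := hH w hw
    obtain ⟨δ, hδ, hδγ⟩ := exists_mem_inducedGroup hγ hγσ
    refine Set.mem_iUnion₂.2 ⟨δ⁻¹, Subgroup.inv_mem _ hδ, δ w, ?_, δ.symm_apply_apply w⟩
    rw [Set.mem_preimage, hδγ]
    exact hγw

theorem IsReductionDatum.isPolyhedralPair
    (hd : IsReductionDatum VQ (rationalHull VQ C) K L Γ G₀)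
    (hS : IsLocallyRationalDecomposition VQ C S) (hinv : ∀ γ ∈ Γ, ∀ τ ∈ S, γ '' τ ∈ S)
    (hσ : σ ∈ S) : IsPolyhedralPair VQ σ (inducedGroup Γ σ) := by
  have h0 := hd.zero_mem hS hσ
  have hσc := hS.isConvexCone σ hσ
  have hhull := hd.rationalHull_preimage_intrinsicInterior hS hσ
  refine ⟨hhull, hd.isRationalStructure_rationalSpan hS hσ,
    hd.isConvexCone_preimage_intrinsicInterior hS hσ, ?_, fun x v hv => ?_,
    image_eq_of_forall_mem ?_, hd.exists_induced_lattice hS hσ, ?_⟩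
  · rw [IsConvexCone.preimage_intrinsicInterior h0]
    exact isOpen_interior
  -- A line in the relative interior of `σ` would be a line in the salient cone `K`.
  · obtain ⟨t, ht⟩ := PointedCone.isNondegenerate hd.isConeLattice.isClosed
      hd.isConeLattice.salient x v (by simpa using hv)
    exact ⟨t, fun h => ht (hd.subset_cone (hS.subset σ hσ (intrinsicInterior_subset h)))⟩
  · rintro δ ⟨γ, -, hγσ, hδ⟩ w hw
    have h := hσc.image_intrinsicInterior h0 γ
    rw [hγσ] at h
    rw [Set.mem_preimage, hδ]
    exact h.subset ⟨w, hw, rfl⟩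
  · rw [hhull]
    exact hd.exists_induced_cone hS hinv hσ

end InducedPair

theorem proposition4 {V : Type*} [NormedAddCommGroup V] [NormedSpace ℝ V] [FiniteDimensional ℝ V]
    [Module ℚ V] (VQ : Submodule ℚ V) (C : Set V) (Γ : Subgroup (V ≃ₗ[ℝ] V))
    (hΓ : IsPolyhedralTriple VQ C Γ)
    (S : Set (Set V)) (hS : IsLocallyRationalDecomposition VQ C S)
    (hinv : ∀ γ ∈ Γ, ∀ τ ∈ S, γ '' τ ∈ S)
    (σ : Set V) (hσ : σ ∈ S) :
    IsPolyhedralPair VQ σ (inducedGroup Γ σ) ∧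
    (∀ γ ∈ pointwiseStabilizer Γ (smallestFace (rationalHull VQ C) σ),
      ∀ τ ∈ coneStar S σ, γ '' τ ∈ coneStar S σ) ∧
    {O | ∃ τ ∈ coneStar S σ,
      O = translates (pointwiseStabilizer Γ (smallestFace (rationalHull VQ C) σ)) τ}.Finite := by
  obtain ⟨K, L, G₀, -, hd⟩ := hΓ.exists_isReductionDatum
  refine ⟨hd.isPolyhedralPair hS hinv hσ, fun γ hγ τ hτ =>
    mem_coneStar_of_mem_pointwiseStabilizer (Set.subset_sInter fun F hF => hF.2) hinv hγ hτ, ?_⟩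
  obtain ⟨T, hT, hstar⟩ := hd.finite_star hS hinv hσ
  -- Every element of the star has a translate in the finite set `T`, and a translate has the same
  -- class.
  refine (hT.image (translates
    (pointwiseStabilizer Γ (smallestFace (rationalHull VQ C) σ)))).subset ?_
  rintro _ ⟨τ, hτ, rfl⟩
  obtain ⟨z, hz, hzT⟩ := hstar τ hτ
  exact ⟨z '' τ, hzT, translates_image hz τ⟩
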